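/- Let $m>0$ and $\mathbb{T}^3=(\mathbb{R}/\mathbb{Z})^3$. For $T>0$, $h\in L^2([0,T];L^2(\mathbb{T}^3))$ and an initial datum $\mathfrak{z}\in H^1(\mathbb{T}^3)$ (all functions real-valued), consider the skeleton equation $$\partial_t w-\Delta w=-w^3-m^2w+h\quad\text{on }[0,T]\times\mathbb{T}^3,\qquad w|_{t=0}=\mathfrak{z}.$$ A (mild) solution is a $w\in C([0,T];H^1(\mathbb{T}^3))$ such that, for all $t\in[0,T]$, $$w(t)=e^{t(\Delta-m^2)}\mathfrak{z}+\int_0^t e^{(t-s)(\Delta-m^2)}\bigl(h(s)-w(s)^3\bigr)\,\mathrm{d}s ,$$ the integral being a Bochner integral in $L^2(\mathbb{T}^3)$. **Proposition (Global Exact Controllability).** For every $T>0$ and every $\phi\in H^1(\mathbb{T}^3)$ there exists $h\in L^2([0,T];L^2(\mathbb{T}^3))$ such that the skeleton equation with driver $h$ and initial datum $\mathfrak{z}=0$ has exactly one solution $w^{h,0}\in C([0,T];H^1(\mathbb{T}^3))$, and this solution satisfies $w^{h,0}(T)=\phi$. -/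

import Mathlib

open MeasureTheory Filter Topology
open scoped ENNReal

noncomputable section

namespace Skeleton

/-- The three-dimensional torus `(ℝ/ℤ)³`. -/
abbrev Torus : Type := UnitAddTorus (Fin 3)

/-- Lebesgue measure on the torus, of total mass one. -/
abbrev torusMeasure : Measure Torus :=
  Measure.pi fun _ : Fin 3 => (AddCircle.haarAddCircle : Measure UnitAddCircle)

/-- The real Hilbert space `L²(𝕋³)`. -/
abbrev L2 : Type := Lp ℝ 2 torusMeasure

/-- The Fourier coefficient `∫ f(x) e^{-2πi k·x} dx`. -/
def torusCoeff (f : L2) (k : Fin 3 → ℤ) : ℂ :=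
  ∫ x, UnitAddTorus.mFourier (-k) x * ((f x : ℝ) : ℂ) ∂torusMeasure

/-- The squared Euclidean length `|k|²` of a frequency. -/
def freqSq (k : Fin 3 → ℤ) : ℝ := ∑ i, (k i : ℝ) ^ 2

/-- The (possibly infinite) norm of `H¹(𝕋³)`, `(∑ₖ (1 + |k|²) |f̂(k)|²)^{1/2}`. -/
def h1Norm (f : L2) : ℝ≥0∞ :=
  (∑' k : Fin 3 → ℤ, ENNReal.ofReal ((1 + freqSq k) * ‖torusCoeff f k‖ ^ 2)) ^ (1 / 2 : ℝ)

/-- Membership in `H¹(𝕋³)`. -/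
def MemH1 (f : L2) : Prop := h1Norm f < ∞

/-- `w` restricted to `[0,T]` belongs to `C([0,T]; H¹(𝕋³))`. -/
def MemCH1 (T : ℝ) (w : ℝ → L2) : Prop :=
  (∀ t ∈ Set.Icc 0 T, MemH1 (w t)) ∧
    ∀ t ∈ Set.Icc 0 T, Tendsto (fun s => h1Norm (w s - w t)) (𝓝[Set.Icc 0 T] t) (𝓝 0)

/-- `h` restricted to `[0,T]` belongs to `L²([0,T]; L²(𝕋³))`. -/
def MemL2L2 (T : ℝ) (h : ℝ → L2) : Prop :=
  MemLp h 2 (volume.restrict (Set.Icc 0 T))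

/-- The real part of `c e^{2πi k·x}`. -/
def realMode (c : ℂ) (k : Fin 3 → ℤ) : C(Torus, ℝ) where
  toFun x := (c * UnitAddTorus.mFourier k x).re
  continuous_toFun := by fun_prop

/-- The semigroup `e^{t(Δ - m²)}`, `t ≥ 0`: the Fourier multiplier with symbol
`e^{-t(4π²|k|² + m²)}`. The series converges in `L²(𝕋³)`; since `f` is real, so is its sum,
and taking the real part of every term does not change it. -/
def heat (m t : ℝ) (f : L2) : L2 :=
  ∑' k : Fin 3 → ℤ, Real.exp (-t * (4 * Real.pi ^ 2 * freqSq k + m ^ 2)) •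
    ContinuousMap.toLp (E := ℝ) 2 torusMeasure ℝ (realMode (torusCoeff f k) k)

open Classical in
/-- The cube `f³` as an element of `L²(𝕋³)`; it is one for every `f ∈ H¹(𝕋³) ⊆ L⁶(𝕋³)`, and the
value `0` is used for the other `f`. -/
def cube (f : L2) : L2 :=
  if hf : MemLp (fun x => f x ^ 3) 2 torusMeasure then hf.toLp _ else 0

/-- `w` is a mild solution in `C([0,T]; H¹(𝕋³))` of
`∂ₜ w - Δ w = -w³ - m² w + h` on `[0,T]`, `w(0) = z`. -/
structure IsMildSolution (m T : ℝ) (h : ℝ → L2) (z : L2) (w : ℝ → L2) : Prop where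
  memCH1 : MemCH1 T w
  integrable : ∀ t ∈ Set.Icc 0 T,
    IntervalIntegrable (fun s => heat m (t - s) (h s - cube (w s))) volume 0 t
  mild : ∀ t ∈ Set.Icc 0 T,
    w t = heat m t z + ∫ s in (0 : ℝ)..t, heat m (t - s) (h s - cube (w s))

end Skeleton

end

/-!
# Exact controllability of the cubic heat equation on the three-dimensional torus

Because the driver `h` is free in `L²([0,T]; L²)`, it suffices to join `0` to `φ` by a curve whose
*linear* defect `∂ₜw - Δw + m²w` is square integrable, and to put the cube of the curve into the
driver. The curve is `w(t) = (t/T) e^{(T-t)(Δ-m²)} φ` (`trajectory`), whose defect has the explicit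
Fourier coefficients of `control`. With `λ` the eigenvalue of `m² - Δ`, the time integral of
`|(1/T + 2λ) e^{-λ(T-s)}|²` is of order `λ`, so the defect is square integrable exactly because
`φ ∈ H¹` (`memL2L2_control`), and Duhamel's formula holds mode by mode (`trajectory_eq_integral`).

The nonlinearity needs the critical embedding `H¹(𝕋³) ⊆ L⁶(𝕋³)` (`lintegral_pow_six_le`). It is
obtained by the argument of Gagliardo and Nirenberg directly on the torus: on every coordinate
circle a function is bounded by its mean plus the integral of its derivative, and Mathlib's
grid-lines inequality for product measures combines the three directions. It makes the cube
locally Lipschitz from `H¹` to `L²` (`enorm_cube_sub_sq_le`), so that the cube of the curve is an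
admissible driver.

For uniqueness, Cauchy–Schwarz in time and Parseval's identity show that an `L²` forcing `N`
produces a solution whose squared `H¹` norm at time `t` is at most a constant times `∫₀ᵗ ‖N‖²`
(`h1Energy_integral_heat_le`). For the difference of two solutions, `N` is a difference of cubes,
and Gronwall's inequality for the squared `H¹` norm of the difference concludes.
-/

noncomputable section

namespace Skeleton

open scoped ComplexConjugate

/-! ### Fourier series in the real space `L²(𝕋³)` -/

/-- The Fourier basis of `L²(𝕋³; ℂ)`, over the measure `torusMeasure`. -/
def fourierBasis : HilbertBasis (Fin 3 → ℤ) ℂ (Lp ℂ 2 torusMeasure) :=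
  UnitAddTorus.mFourierBasis

/-- The character `e^{2πi k·x}` as an element of `L²(𝕋³; ℂ)`. -/
abbrev characterLp (k : Fin 3 → ℤ) : Lp ℂ 2 torusMeasure :=
  ContinuousMap.toLp (E := ℂ) 2 torusMeasure ℂ (UnitAddTorus.mFourier k)

/-- The inclusion `L²(𝕋³; ℝ) → L²(𝕋³; ℂ)`. -/
def toComplex : L2 →L[ℝ] Lp ℂ 2 torusMeasure :=
  Complex.ofRealCLM.compLpL 2 torusMeasure

/-- The real part `L²(𝕋³; ℂ) → L²(𝕋³; ℝ)`. -/
def rePart : Lp ℂ 2 torusMeasure →L[ℝ] L2 :=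
  Complex.reCLM.compLpL 2 torusMeasure

/-- The continuous function `Re (c e^{2πi k·x})` as an element of `L²(𝕋³)`. -/
abbrev modeLp (c : ℂ) (k : Fin 3 → ℤ) : L2 :=
  ContinuousMap.toLp (E := ℝ) 2 torusMeasure ℝ (realMode c k)

lemma fourierBasis_apply (k : Fin 3 → ℤ) : fourierBasis k = characterLp k := by
  have := congrFun (UnitAddTorus.coe_mFourierBasis (d := Fin 3)) k
  exact this

lemma coeFn_toComplex (f : L2) : toComplex f =ᵐ[torusMeasure] fun x => ((f x : ℝ) : ℂ) :=
  Complex.ofRealCLM.coeFn_compLpL f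

lemma coeFn_rePart (f : Lp ℂ 2 torusMeasure) : rePart f =ᵐ[torusMeasure] fun x => (f x).re :=
  Complex.reCLM.coeFn_compLpL f

lemma coeFn_modeLp (c : ℂ) (k : Fin 3 → ℤ) : modeLp c k =ᵐ[torusMeasure] realMode c k :=
  ContinuousMap.coeFn_toLp torusMeasure _

lemma coeFn_characterLp (k : Fin 3 → ℤ) :
    characterLp k =ᵐ[torusMeasure] UnitAddTorus.mFourier k :=
  ContinuousMap.coeFn_toLp torusMeasure _

lemma norm_toComplex (f : L2) : ‖toComplex f‖ = ‖f‖ := by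
  rw [Lp.norm_def, Lp.norm_def, eLpNorm_congr_norm_ae (g := f)]
  filter_upwards [coeFn_toComplex f] with x hx
  simp [hx]

lemma torusCoeff_eq_repr (f : L2) (k : Fin 3 → ℤ) :
    torusCoeff f k = fourierBasis.repr (toComplex f) k := by
  have h : fourierBasis.repr (toComplex f) k
      = ∫ x, UnitAddTorus.mFourier (-k) x • toComplex f x ∂torusMeasure :=
    UnitAddTorus.mFourierBasis_repr (toComplex f) k
  rw [h, torusCoeff]
  refine integral_congr_ae ?_
  filter_upwards [coeFn_toComplex f] with x hx
  simp [hx]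

/-- The `k`-th Fourier coefficient as a continuous real-linear map. -/
def coeffCLM (k : Fin 3 → ℤ) : L2 →L[ℝ] ℂ :=
  ((innerSL ℂ (characterLp k)).restrictScalars ℝ) ∘L toComplex

lemma coeffCLM_apply (k : Fin 3 → ℤ) (f : L2) : coeffCLM k f = torusCoeff f k := by
  rw [torusCoeff_eq_repr, HilbertBasis.repr_apply_apply, fourierBasis_apply]
  rfl

@[simp] lemma torusCoeff_zero (k : Fin 3 → ℤ) : torusCoeff 0 k = 0 := by
  simp [← coeffCLM_apply]

lemma torusCoeff_add (f g : L2) (k : Fin 3 → ℤ) :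
    torusCoeff (f + g) k = torusCoeff f k + torusCoeff g k := by
  simp [← coeffCLM_apply]

lemma torusCoeff_sub (f g : L2) (k : Fin 3 → ℤ) :
    torusCoeff (f - g) k = torusCoeff f k - torusCoeff g k := by
  simp [← coeffCLM_apply]

lemma torusCoeff_smul (r : ℝ) (f : L2) (k : Fin 3 → ℤ) :
    torusCoeff (r • f) k = r * torusCoeff f k := by
  simp [← coeffCLM_apply]

lemma torusCoeff_neg_freq (f : L2) (k : Fin 3 → ℤ) :
    torusCoeff f (-k) = conj (torusCoeff f k) := by
  rw [torusCoeff, torusCoeff, ← integral_conj]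
  refine integral_congr_ae (ae_of_all _ fun x => ?_)
  simp only [map_mul, ← UnitAddTorus.mFourier_neg, Complex.conj_ofReal]

/-- **Parseval's identity** on the real space `L²(𝕋³)`. -/
lemma hasSum_sq_torusCoeff (f : L2) : HasSum (fun k => ‖torusCoeff f k‖ ^ 2) (‖f‖ ^ 2) := by
  have h := lp.hasSum_norm (p := 2) (by norm_num) (fourierBasis.repr (toComplex f))
  simpa [LinearIsometryEquiv.norm_map, norm_toComplex, torusCoeff_eq_repr] using h

lemma enorm_sq_eq_tsum (f : L2) : ‖f‖ₑ ^ 2 = ∑' k, ‖torusCoeff f k‖ₑ ^ 2 := by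
  have h := hasSum_sq_torusCoeff f
  have h2 := ENNReal.ofReal_tsum_of_nonneg (fun k => by positivity) h.summable
  rw [h.tsum_eq] at h2
  simpa [ENNReal.ofReal_pow, ofReal_norm] using h2

lemma enorm_sq_eq_lintegral (f : L2) : ‖f‖ₑ ^ 2 = ∫⁻ x, ‖f x‖ₑ ^ 2 ∂torusMeasure := by
  rw [Lp.enorm_def, eLpNorm_eq_lintegral_rpow_enorm_toReal (by norm_num) (by norm_num),
    ← ENNReal.rpow_natCast, ← ENNReal.rpow_mul]
  norm_num

lemma ext_torusCoeff {f g : L2} (h : ∀ k, torusCoeff f k = torusCoeff g k) : f = g := by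
  have h1 := hasSum_sq_torusCoeff (f - g)
  simp only [torusCoeff_sub, h, sub_self, norm_zero, ne_eq, OfNat.ofNat_ne_zero,
    not_false_eq_true, zero_pow] at h1
  have h2 := h1.unique hasSum_zero
  simpa [sub_eq_zero] using h2

lemma rePart_smul_characterLp (c : ℂ) (k : Fin 3 → ℤ) :
    rePart (c • characterLp k) = modeLp c k := by
  refine Lp.ext ?_
  filter_upwards [coeFn_rePart (c • characterLp k), coeFn_modeLp c k, coeFn_characterLp k,
    Lp.coeFn_smul c (characterLp k)] with x h1 h2 h3 h4
  rw [h1, h2, h4, Pi.smul_apply, h3]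
  rfl

/-- `Re (c e^{2πi k·x})` is a combination of the characters of frequencies `k` and `-k`. -/
lemma toComplex_modeLp (c : ℂ) (k : Fin 3 → ℤ) :
    toComplex (modeLp c k) = (c / 2) • characterLp k + (conj c / 2) • characterLp (-k) := by
  refine Lp.ext ?_
  filter_upwards [coeFn_toComplex (modeLp c k), coeFn_modeLp c k, coeFn_characterLp k,
    coeFn_characterLp (-k), Lp.coeFn_smul (c / 2) (characterLp k),
    Lp.coeFn_smul (conj c / 2) (characterLp (-k)),
    Lp.coeFn_add ((c / 2) • characterLp k) ((conj c / 2) • characterLp (-k))]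
    with x h1 h2 h3 h4 h5 h6 h7
  rw [h1, h2, h7, Pi.add_apply, h5, h6, Pi.smul_apply, Pi.smul_apply, h3, h4,
    UnitAddTorus.mFourier_neg]
  change (((c * UnitAddTorus.mFourier k x).re : ℝ) : ℂ) = _
  rw [Complex.re_eq_add_conj, map_mul, smul_eq_mul, smul_eq_mul]
  ring

lemma inner_characterLp (j k : Fin 3 → ℤ) :
    inner ℂ (characterLp j) (characterLp k) = if j = k then (1 : ℂ) else 0 := by
  have h := orthonormal_iff_ite.mp fourierBasis.orthonormal j k
  rwa [fourierBasis_apply, fourierBasis_apply] at h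

lemma torusCoeff_modeLp (c : ℂ) (k j : Fin 3 → ℤ) :
    torusCoeff (modeLp c k) j
      = (if k = j then c / 2 else 0) + (if k = -j then conj c / 2 else 0) := by
  have h : (j = -k) ↔ (k = -j) := by rw [eq_comm, neg_eq_iff_eq_neg]
  rw [torusCoeff_eq_repr, HilbertBasis.repr_apply_apply, fourierBasis_apply, toComplex_modeLp,
    inner_add_right, inner_smul_right, inner_smul_right, inner_characterLp, inner_characterLp]
  simp [h, eq_comm]

lemma torusCoeff_tsum_modeLp {c : (Fin 3 → ℤ) → ℂ} (hsymm : ∀ k, c (-k) = conj (c k)) {f : L2}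
    (hf : HasSum (fun k => modeLp (c k) k) f) (j : Fin 3 → ℤ) : torusCoeff f j = c j := by
  have h1 : HasSum (fun k => torusCoeff (modeLp (c k) k) j) (torusCoeff f j) := by
    simpa only [coeffCLM_apply] using (coeffCLM j).hasSum hf
  refine h1.unique ?_
  simp only [torusCoeff_modeLp]
  have h2 : HasSum (fun k => if k = j then c k / 2 else 0) (c j / 2) := by
    convert hasSum_ite_eq j (c j / 2) using 2 with k
    split_ifs with h <;> simp [h]
  have h3 : HasSum (fun k => if k = -j then conj (c k) / 2 else 0) (c j / 2) := by
    -- the symmetry turns the contribution of the mode `-j` into a second half of `c j`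
    convert hasSum_ite_eq (-j) (c j / 2) using 2 with k
    split_ifs with h <;> simp [h, hsymm]
  simpa using h2.add h3

/-- A square summable family `c` with `c (-k) = conj (c k)` is the family of Fourier coefficients
of the sum, unconditional in `L²(𝕋³)`, of the real modes `Re (c k e^{2πi k·x})`. -/
lemma exists_hasSum_modeLp {c : (Fin 3 → ℤ) → ℂ} (hc : Summable fun k => ‖c k‖ ^ 2)
    (hsymm : ∀ k, c (-k) = conj (c k)) :
    ∃ f : L2, HasSum (fun k => modeLp (c k) k) f ∧ ∀ k, torusCoeff f k = c k := by
  have hmem : Memℓp c 2 := memℓp_gen (by simpa using hc)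
  obtain ⟨F, hF⟩ : ∃ F, HasSum (fun k => c k • characterLp k) F := by
    refine ⟨_, (fourierBasis.hasSum_repr_symm ⟨c, hmem⟩).congr_fun fun k => ?_⟩
    rw [fourierBasis_apply]
  have hre : HasSum (fun k => modeLp (c k) k) (rePart F) := by
    simpa only [rePart_smul_characterLp] using rePart.hasSum hF
  exact ⟨_, hre, torusCoeff_tsum_modeLp hsymm hre⟩

/-- The Fourier series of `f`, written with real modes, converges to `f` in `L²(𝕋³)`. -/
lemma hasSum_modeLp_torusCoeff (f : L2) : HasSum (fun k => modeLp (torusCoeff f k) k) f := by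
  obtain ⟨g, hg, hgc⟩ := exists_hasSum_modeLp (hasSum_sq_torusCoeff f).summable
    (torusCoeff_neg_freq f)
  rwa [ext_torusCoeff hgc] at hg

/-! ### Fourier multipliers and the heat semigroup -/

/-- The square of the Sobolev norm. -/
def h1Energy (f : L2) : ℝ≥0∞ :=
  ∑' k : Fin 3 → ℤ, ENNReal.ofReal ((1 + freqSq k) * ‖torusCoeff f k‖ ^ 2)

/-- The eigenvalue `4π²|k|² + m²` of `m² - Δ` at the frequency `k`. -/
def symbol (m : ℝ) (k : Fin 3 → ℤ) : ℝ := 4 * Real.pi ^ 2 * freqSq k + m ^ 2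

lemma freqSq_nonneg (k : Fin 3 → ℤ) : 0 ≤ freqSq k := Finset.sum_nonneg fun _ _ => sq_nonneg _

@[simp] lemma freqSq_neg (k : Fin 3 → ℤ) : freqSq (-k) = freqSq k := by simp [freqSq]

@[simp] lemma symbol_neg (m : ℝ) (k : Fin 3 → ℤ) : symbol m (-k) = symbol m k := by
  simp [symbol]

lemma symbol_nonneg (m : ℝ) (k : Fin 3 → ℤ) : 0 ≤ symbol m k := by
  have := freqSq_nonneg k
  unfold symbol; positivity

lemma symbol_pos {m : ℝ} (hm : 0 < m) (k : Fin 3 → ℤ) : 0 < symbol m k := by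
  have := freqSq_nonneg k
  unfold symbol; positivity

/-- Fourier multipliers with an even real symbol, applied to a real function. -/
lemma exists_hasSum_multiplier (a : (Fin 3 → ℤ) → ℝ) (ha : ∀ k, a (-k) = a k) (f : L2)
    (hs : Summable fun k => (a k) ^ 2 * ‖torusCoeff f k‖ ^ 2) :
    ∃ g : L2, HasSum (fun k => a k • modeLp (torusCoeff f k) k) g ∧
      ∀ k, torusCoeff g k = a k * torusCoeff f k := by
  obtain ⟨g, hg, hgc⟩ := exists_hasSum_modeLp (c := fun k => a k * torusCoeff f k)
    (by simpa [mul_pow] using hs) (by simp [ha, torusCoeff_neg_freq])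
  refine ⟨g, ?_, hgc⟩
  convert hg using 2 with k
  rw [← map_smul]
  congr 1
  ext x
  simp [realMode, mul_assoc]

lemma exp_symbol_le_one {m t : ℝ} (ht : 0 ≤ t) (k : Fin 3 → ℤ) :
    Real.exp (-t * symbol m k) ≤ 1 := by
  rw [Real.exp_le_one_iff]
  nlinarith [mul_nonneg ht (symbol_nonneg m k)]

lemma hasSum_heat_and_torusCoeff_heat {m t : ℝ} (ht : 0 ≤ t) (f : L2) :
    HasSum (fun k => Real.exp (-t * symbol m k) • modeLp (torusCoeff f k) k) (heat m t f) ∧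
      ∀ k, torusCoeff (heat m t f) k = Real.exp (-t * symbol m k) * torusCoeff f k := by
  obtain ⟨g, hg, hgc⟩ := exists_hasSum_multiplier (fun k => Real.exp (-t * symbol m k))
    (by simp) f (by
      refine Summable.of_nonneg_of_le (fun k => by positivity) (fun k => ?_)
        (hasSum_sq_torusCoeff f).summable
      refine mul_le_of_le_one_left (by positivity) ?_
      exact pow_le_one₀ (Real.exp_nonneg _) (exp_symbol_le_one ht k))
  have : heat m t f = g := hg.tsum_eq
  rw [this]
  exact ⟨hg, hgc⟩

lemma hasSum_heat {m t : ℝ} (ht : 0 ≤ t) (f : L2) :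
    HasSum (fun k => Real.exp (-t * symbol m k) • modeLp (torusCoeff f k) k) (heat m t f) :=
  (hasSum_heat_and_torusCoeff_heat ht f).1

lemma torusCoeff_heat {m t : ℝ} (ht : 0 ≤ t) (f : L2) (k : Fin 3 → ℤ) :
    torusCoeff (heat m t f) k = Real.exp (-t * symbol m k) * torusCoeff f k :=
  (hasSum_heat_and_torusCoeff_heat ht f).2 k

lemma norm_torusCoeff_heat_le {m t : ℝ} (ht : 0 ≤ t) (f : L2) (k : Fin 3 → ℤ) :
    ‖torusCoeff (heat m t f) k‖ ≤ ‖torusCoeff f k‖ := by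
  rw [torusCoeff_heat ht, norm_mul, Complex.norm_real, Real.norm_eq_abs, Real.abs_exp]
  exact mul_le_of_le_one_left (norm_nonneg _) (exp_symbol_le_one ht k)

lemma norm_heat_le {m t : ℝ} (ht : 0 ≤ t) (f : L2) : ‖heat m t f‖ ≤ ‖f‖ := by
  refine le_of_sq_le_sq ?_ (norm_nonneg _)
  exact hasSum_le (fun k => by gcongr; exact norm_torusCoeff_heat_le ht f k)
    (hasSum_sq_torusCoeff _) (hasSum_sq_torusCoeff f)

lemma heat_sub {m t : ℝ} (ht : 0 ≤ t) (f g : L2) :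
    heat m t (f - g) = heat m t f - heat m t g := by
  refine ext_torusCoeff fun k => ?_
  simp only [torusCoeff_heat ht, torusCoeff_sub, mul_sub]

lemma heat_zero {m t : ℝ} (ht : 0 ≤ t) : heat m t 0 = 0 :=
  ext_torusCoeff fun k => by simp [torusCoeff_heat ht]

/-! ### The Sobolev embedding `H¹(𝕋³) ⊆ L⁶(𝕋³)` -/

/-- `du` is the partial derivative of `u` in the `i`-th coordinate. -/
def HasPartialDeriv (i : Fin 3) (u du : C(Torus, ℝ)) : Prop :=
  ∀ (x : Torus) (y : ℝ), HasDerivAt (fun y : ℝ => u (Function.update x i (y : UnitAddCircle)))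
    (du (Function.update x i (y : UnitAddCircle))) y

lemma HasPartialDeriv.sum {ι : Type*} {i : Fin 3} (s : Finset ι) {u du : ι → C(Torus, ℝ)}
    (h : ∀ k ∈ s, HasPartialDeriv i (u k) (du k)) :
    HasPartialDeriv i (∑ k ∈ s, u k) (∑ k ∈ s, du k) := by
  intro x y
  simp only [ContinuousMap.sum_apply]
  exact HasDerivAt.fun_sum fun k hk => h k hk x y

lemma HasPartialDeriv.pow_four {i : Fin 3} {u du : C(Torus, ℝ)} (h : HasPartialDeriv i u du) :
    HasPartialDeriv i (u ^ 4) ((4 : ℝ) • (u ^ 3 * du)) := by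
  intro x y
  convert! (h x y).pow 4 using 1
  simp [mul_assoc]

lemma mFourier_update (k : Fin 3 → ℤ) (x : Torus) (i : Fin 3) (ξ : UnitAddCircle) :
    UnitAddTorus.mFourier k (Function.update x i ξ)
      = (∏ j ∈ Finset.univ.erase i, fourier (k j) (x j)) * fourier (k i) ξ := by
  change ∏ j, fourier (k j) (Function.update x i ξ j) = _
  rw [← Finset.prod_erase_mul _ _ (Finset.mem_univ i), Function.update_self]
  congr 1
  refine Finset.prod_congr rfl fun j hj => ?_
  rw [Function.update_of_ne (Finset.ne_of_mem_erase hj)]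

lemma hasPartialDeriv_realMode (c : ℂ) (k : Fin 3 → ℤ) (i : Fin 3) :
    HasPartialDeriv i (realMode c k) (realMode (2 * Real.pi * Complex.I * k i * c) k) := by
  intro x y
  have h1 := (hasDerivAt_fourier (1 : ℝ) (k i) y).const_mul
    (c * ∏ j ∈ Finset.univ.erase i, fourier (k j) (x j))
  have h2 := Complex.reCLM.hasFDerivAt.comp_hasDerivAt y h1
  change HasDerivAt (fun y : ℝ => (c * UnitAddTorus.mFourier k
      (Function.update x i (y : UnitAddCircle))).re)
    (2 * Real.pi * Complex.I * k i * c *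
      UnitAddTorus.mFourier k (Function.update x i (y : UnitAddCircle))).re y
  simp only [mFourier_update]
  convert! h2 using 1
  · funext z
    simp only [Function.comp_apply, Complex.reCLM_apply]
    rw [mul_assoc]
  · simp only [Complex.reCLM_apply, Complex.ofReal_one, div_one]
    congr 1
    ring

/-- A function on `[0, 1]` is at most its mean plus the integral of the modulus of its
derivative. -/
lemma le_integral_add_abs_deriv {V V' : ℝ → ℝ} (hV : ∀ y, HasDerivAt V (V' y) y)
    (hV' : Continuous V') {y : ℝ} (hy : y ∈ Set.Icc (0 : ℝ) 1) :
    V y ≤ ∫ z in (0 : ℝ)..1, (V z + |V' z|) := by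
  have hVc : Continuous V := continuous_iff_continuousAt.2 fun z => (hV z).continuousAt
  have hint : ∀ a b, IntervalIntegrable (fun z => |V' z|) volume a b := fun a b =>
    hV'.abs.intervalIntegrable a b
  have key : ∀ z ∈ Set.Icc (0 : ℝ) 1, V y - ∫ s in (0 : ℝ)..1, |V' s| ≤ V z := by
    intro z hz
    have h1 : ∫ s in z..y, V' s = V y - V z :=
      intervalIntegral.integral_eq_sub_of_hasDerivAt (fun s _ => hV s)
        (hV'.intervalIntegrable z y)
    have h2 : |∫ s in z..y, V' s| ≤ ∫ s in (0 : ℝ)..1, |V' s| := by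
      refine (intervalIntegral.norm_integral_le_integral_norm_uIoc (f := V')).trans ?_
      rw [intervalIntegral.integral_of_le zero_le_one]
      refine setIntegral_mono_set (hint 0 1).1 (ae_of_all _ fun s => norm_nonneg _) ?_
      refine LE.le.eventuallyLE fun s hs => ?_
      rw [Set.mem_uIoc] at hs
      rcases hs with hs | hs
      · exact ⟨hz.1.trans_lt hs.1, hs.2.trans hy.2⟩
      · exact ⟨hy.1.trans_lt hs.1, hs.2.trans hz.2⟩
    have := (le_abs_self _).trans h2
    linarith
  have h3 := intervalIntegral.integral_mono_on (zero_le_one' ℝ)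
    (intervalIntegrable_const (μ := volume)) (hVc.intervalIntegrable 0 1) key
  rw [intervalIntegral.integral_const] at h3
  rw [intervalIntegral.integral_add (hVc.intervalIntegrable 0 1) (hint 0 1)]
  simp only [sub_zero, one_smul] at h3
  linarith

lemma haarAddCircle_eq_volume :
    (AddCircle.haarAddCircle : Measure UnitAddCircle) = volume := by
  simp [AddCircle.volume_eq_smul_haarAddCircle]

/-- A nonnegative function on the torus is bounded at `x` by the integral of itself and of its
partial derivative along the circle through `x` in the `i`-th direction. -/
lemma ofReal_le_lintegral_update {i : Fin 3} {v dv : C(Torus, ℝ)} (h : HasPartialDeriv i v dv)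
    (hv : ∀ x, 0 ≤ v x) (x : Torus) :
    ENNReal.ofReal (v x) ≤
      ∫⁻ ξ, ENNReal.ofReal (v (Function.update x i ξ) + |dv (Function.update x i ξ)|)
        ∂AddCircle.haarAddCircle := by
  obtain ⟨y, hy, hyx⟩ : ∃ y ∈ Set.Icc (0 : ℝ) 1, (y : UnitAddCircle) = x i := by
    refine ⟨(AddCircle.equivIco 1 0 (x i) : ℝ), ?_, AddCircle.coe_equivIco⟩
    have := (AddCircle.equivIco 1 0 (x i)).2
    exact ⟨this.1, by simpa using this.2.le⟩
  have hup : Continuous fun y : ℝ => Function.update x i (y : UnitAddCircle) :=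
    continuous_const.update i (AddCircle.continuous_mk' 1)
  have h1 := le_integral_add_abs_deriv (h x) (dv.continuous.comp hup) hy
  rw [hyx, Function.update_eq_self] at h1
  rw [haarAddCircle_eq_volume, ← UnitAddCircle.lintegral_preimage 0, zero_add,
    ← ofReal_integral_eq_lintegral_ofReal]
  · rw [← intervalIntegral.integral_of_le zero_le_one]
    exact ENNReal.ofReal_le_ofReal h1
  · refine Continuous.integrableOn_Ioc ?_
    exact (v.continuous.comp hup).add (dv.continuous.comp hup).abs
  · exact ae_of_all _ fun z => add_nonneg (hv _) (abs_nonneg _)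

/-- The Gagliardo–Nirenberg–Sobolev argument on the torus: the grid-lines inequality applied
to `u⁴`. -/
lemma lintegral_enorm_pow_six_le {u : C(Torus, ℝ)} {du : Fin 3 → C(Torus, ℝ)}
    (h : ∀ i, HasPartialDeriv i u (du i)) :
    ∫⁻ x, ‖u x‖ₑ ^ 6 ∂torusMeasure
      ≤ (∫⁻ x, ENNReal.ofReal (|u x| + 4 * ∑ i, |du i x|) ^ 2 ∂torusMeasure) ^ 3 := by
  set B : Torus → ℝ≥0∞ := fun x => ENNReal.ofReal (|u x| + 4 * ∑ i, |du i x|) with hB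
  have hBm : Measurable B := by
    refine (ENNReal.continuous_ofReal.comp ?_).measurable
    fun_prop
  have hum : Measurable fun x => ‖u x‖ₑ := u.continuous.enorm.measurable
  set F : Torus → ℝ≥0∞ := fun x => ‖u x‖ₑ ^ 3 * B x with hF
  have hFm : Measurable F := (hum.pow_const 3).mul hBm
  set A := ∫⁻ x, ‖u x‖ₑ ^ 6 ∂torusMeasure with hA
  set Q := ∫⁻ x, B x ^ 2 ∂torusMeasure with hQ
  have hline : ∀ x i, ‖u x‖ₑ ^ 4 ≤
      ∫⁻ ξ, F (Function.update x i ξ) ∂AddCircle.haarAddCircle := by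
    intro x i
    have h1 := ofReal_le_lintegral_update (h i).pow_four
      (fun x => by simpa using (by decide : Even 4).pow_nonneg (u x)) x
    have h2 : ENNReal.ofReal ((u ^ 4) x) = ‖u x‖ₑ ^ 4 := by
      rw [Real.enorm_eq_ofReal_abs, ← ENNReal.ofReal_pow (abs_nonneg _),
        (by decide : Even 4).pow_abs]
      rfl
    rw [h2] at h1
    refine h1.trans (lintegral_mono fun ξ => ?_)
    simp only [hF, hB]
    rw [Real.enorm_eq_ofReal_abs, ← ENNReal.ofReal_pow (abs_nonneg _),
      ← ENNReal.ofReal_mul (by positivity)]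
    refine ENNReal.ofReal_le_ofReal ?_
    set z := Function.update x i ξ
    have hle : |du i z| ≤ ∑ i, |du i z| :=
      Finset.single_le_sum (f := fun i => |du i z|) (fun _ _ => abs_nonneg _)
        (Finset.mem_univ i)
    change u z ^ 4 + |4 * (u z ^ 3 * du i z)| ≤ _
    rw [abs_mul, abs_mul, abs_pow, ← (by decide : Even 4).pow_abs (u z),
      abs_of_pos (by norm_num : (0 : ℝ) < 4)]
    have := mul_le_mul_of_nonneg_left hle (pow_nonneg (abs_nonneg (u z)) 3)
    nlinarith
  -- `u⁶` is the product over the three directions of `(u⁴)^{1/2}`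
  have hgrid : A ≤ (∫⁻ x, F x ∂torusMeasure) ^ (3 / 2 : ℝ) := by
    have hconj : Real.HolderConjugate (Fintype.card (Fin 3)) (3 / 2) := by
      rw [Real.holderConjugate_iff]; norm_num
    refine le_trans (lintegral_mono fun x => ?_) (lintegral_prod_lintegral_pow_le
      (fun _ : Fin 3 => (AddCircle.haarAddCircle : Measure UnitAddCircle)) hconj hFm)
    calc ‖u x‖ₑ ^ 6 = ∏ _i : Fin 3, (‖u x‖ₑ ^ 4) ^ ((1 : ℝ) / 2) := by
          rw [Finset.prod_const, ← ENNReal.rpow_natCast, ← ENNReal.rpow_natCast,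
            ← ENNReal.rpow_mul, ← ENNReal.rpow_natCast, ← ENNReal.rpow_mul]
          norm_num
      _ ≤ _ := by
          have h32 : ((Fintype.card (Fin 3) : ℝ) - 1) = 2 := by norm_num
          rw [h32]
          exact Finset.prod_le_prod' fun i _ => by gcongr; exact hline x i
  have hCS : ∫⁻ x, F x ∂torusMeasure ≤ A ^ (1 / 2 : ℝ) * Q ^ (1 / 2 : ℝ) := by
    have := ENNReal.lintegral_mul_le_Lp_mul_Lq torusMeasure
      (Real.HolderConjugate.two_two) (hum.pow_const 3).aemeasurable hBm.aemeasurable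
    refine this.trans (le_of_eq ?_)
    simp only [hA, hQ, ENNReal.rpow_two, ← pow_mul]
  have hfin : A ≠ ∞ := by
    refine ne_of_lt ?_
    refine lt_of_le_of_lt (lintegral_mono (g := fun _ => ENNReal.ofReal ‖u‖ ^ 6) fun x => ?_) ?_
    · refine pow_le_pow_left' ?_ 6
      rw [← ofReal_norm]
      exact ENNReal.ofReal_le_ofReal (u.norm_coe_le_norm x)
    · simp
  -- grid lines and Cauchy–Schwarz give `A ≤ A^{3/4} Q^{3/4}`; since `A` is finite, it cancels
  have h4 : A ^ 4 ≤ A ^ 3 * Q ^ 3 := by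
    have h5 : A ≤ (A ^ (1 / 2 : ℝ) * Q ^ (1 / 2 : ℝ)) ^ (3 / 2 : ℝ) :=
      hgrid.trans (ENNReal.rpow_le_rpow hCS (by norm_num))
    calc A ^ 4 ≤ ((A ^ (1 / 2 : ℝ) * Q ^ (1 / 2 : ℝ)) ^ (3 / 2 : ℝ)) ^ 4 := by gcongr
      _ = A ^ 3 * Q ^ 3 := by
        rw [← ENNReal.rpow_natCast, ← ENNReal.rpow_mul,
          ENNReal.mul_rpow_of_nonneg _ _ (by norm_num), ← ENNReal.rpow_mul, ← ENNReal.rpow_mul]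
        norm_num
  by_cases hA0 : A = 0
  · simp [hA0]
  · rw [pow_succ] at h4
    exact (ENNReal.mul_le_mul_iff_right (pow_ne_zero 3 hA0) (ENNReal.pow_ne_top hfin)).1 h4

lemma norm_rePart_le (F : Lp ℂ 2 torusMeasure) : ‖rePart F‖ ≤ ‖F‖ := by
  refine Lp.norm_le_norm_of_ae_le ?_
  filter_upwards [coeFn_rePart F] with x hx
  rw [hx]
  exact Complex.abs_re_le_norm _

lemma norm_sum_modeLp_sq_le (s : Finset (Fin 3 → ℤ)) (c : (Fin 3 → ℤ) → ℂ) :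
    ‖∑ k ∈ s, modeLp (c k) k‖ ^ 2 ≤ ∑ k ∈ s, ‖c k‖ ^ 2 := by
  have h1 : ∑ k ∈ s, modeLp (c k) k = rePart (∑ k ∈ s, c k • characterLp k) := by
    simp only [map_sum, rePart_smul_characterLp]
  have h2 : ‖∑ k ∈ s, c k • characterLp k‖ ^ 2 = ∑ k ∈ s, ‖c k‖ ^ 2 := by
    have hO : Orthonormal ℂ characterLp := by
      have := fourierBasis.orthonormal
      rwa [show (fourierBasis : (Fin 3 → ℤ) → Lp ℂ 2 torusMeasure) = characterLp from
        funext fourierBasis_apply] at this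
    have h3 := hO.inner_sum c c s
    have h4 := inner_self_eq_norm_sq_to_K (𝕜 := ℂ) (∑ k ∈ s, c k • characterLp k)
    rw [h3] at h4
    simp only [Complex.conj_mul'] at h4
    have h5 : ((‖∑ k ∈ s, c k • characterLp k‖ ^ 2 : ℝ) : ℂ) = ((∑ k ∈ s, ‖c k‖ ^ 2 : ℝ) : ℂ) := by
      push_cast
      exact h4.symm
    exact Complex.ofReal_injective h5
  rw [h1, ← h2]
  gcongr
  exact norm_rePart_le _

lemma lintegral_enorm_sq_sum_realMode_le (s : Finset (Fin 3 → ℤ)) (c : (Fin 3 → ℤ) → ℂ) :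
    ∫⁻ x, ‖(∑ k ∈ s, realMode (c k) k) x‖ₑ ^ 2 ∂torusMeasure
      ≤ ENNReal.ofReal (∑ k ∈ s, ‖c k‖ ^ 2) := by
  set u := ∑ k ∈ s, realMode (c k) k with hu
  have h1 : ContinuousMap.toLp (E := ℝ) 2 torusMeasure ℝ u = ∑ k ∈ s, modeLp (c k) k := by
    rw [hu, map_sum]
  have h2 : ∫⁻ x, ‖u x‖ₑ ^ 2 ∂torusMeasure
      = ‖ContinuousMap.toLp (E := ℝ) 2 torusMeasure ℝ u‖ₑ ^ 2 := by
    rw [enorm_sq_eq_lintegral]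
    refine lintegral_congr_ae ?_
    filter_upwards [ContinuousMap.coeFn_toLp (E := ℝ) (p := 2) (𝕜 := ℝ) torusMeasure u] with x hx
    rw [hx]
  rw [h2, h1, ← ofReal_norm, ← ENNReal.ofReal_pow (norm_nonneg _)]
  exact ENNReal.ofReal_le_ofReal (norm_sum_modeLp_sq_le s c)

/-- A constant for the embedding `H¹(𝕋³) ⊆ L⁶(𝕋³)`, with respect to the squared norms. -/
def sobolevConst : ℝ := 256 * Real.pi ^ 2

/-- The Sobolev embedding for real trigonometric polynomials. -/
lemma lintegral_pow_six_sum_realMode_le (s : Finset (Fin 3 → ℤ)) (c : (Fin 3 → ℤ) → ℂ) :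
    ∫⁻ x, ‖(∑ k ∈ s, realMode (c k) k) x‖ₑ ^ 6 ∂torusMeasure
      ≤ ENNReal.ofReal (sobolevConst * ∑ k ∈ s, (1 + freqSq k) * ‖c k‖ ^ 2) ^ 3 := by
  set u := ∑ k ∈ s, realMode (c k) k with hu
  set d : Fin 3 → (Fin 3 → ℤ) → ℂ := fun i k => 2 * Real.pi * Complex.I * k i * c k with hd
  set du : Fin 3 → C(Torus, ℝ) := fun i => ∑ k ∈ s, realMode (d i k) k with hdu
  have hpart : ∀ i, HasPartialDeriv i u (du i) := fun i =>
    HasPartialDeriv.sum s fun k _ => hasPartialDeriv_realMode (c k) k i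
  refine (lintegral_enorm_pow_six_le hpart).trans ?_
  gcongr
  -- Cauchy–Schwarz for a sum of four terms, whence `64 = 4 * 4²`
  have hpt : ∀ x, ENNReal.ofReal (|u x| + 4 * ∑ i, |du i x|) ^ 2
      ≤ 4 * ‖u x‖ₑ ^ 2 + ∑ i, 64 * ‖du i x‖ₑ ^ 2 := by
    intro x
    simp only [Fin.sum_univ_three, Real.enorm_eq_ofReal_abs]
    rw [show (4 : ℝ≥0∞) = ENNReal.ofReal 4 by simp, show (64 : ℝ≥0∞) = ENNReal.ofReal 64 by simp]
    simp only [← ENNReal.ofReal_pow (abs_nonneg _)]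
    rw [← ENNReal.ofReal_pow (by positivity)]
    simp only [← ENNReal.ofReal_mul (show (0 : ℝ) ≤ 4 by norm_num),
      ← ENNReal.ofReal_mul (show (0 : ℝ) ≤ 64 by norm_num)]
    rw [← ENNReal.ofReal_add (by positivity) (by positivity),
      ← ENNReal.ofReal_add (by positivity) (by positivity),
      ← ENNReal.ofReal_add (by positivity) (by positivity)]
    refine ENNReal.ofReal_le_ofReal ?_
    generalize |u x| = a
    generalize |du 0 x| = b
    generalize |du 1 x| = e
    generalize |du 2 x| = f
    nlinarith [sq_nonneg (a - 4 * b), sq_nonneg (a - 4 * e), sq_nonneg (a - 4 * f),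
      sq_nonneg (b - e), sq_nonneg (b - f), sq_nonneg (e - f)]
  have hm : ∀ v : C(Torus, ℝ), Measurable fun x => ‖v x‖ₑ ^ 2 := fun v =>
    v.continuous.enorm.measurable.pow_const 2
  have hnd : ∀ i k, ‖d i k‖ ^ 2 = 4 * Real.pi ^ 2 * (k i : ℝ) ^ 2 * ‖c k‖ ^ 2 := by
    intro i k
    simp only [hd, norm_mul, Complex.norm_I, Complex.norm_ofNat, Complex.norm_real,
      Complex.norm_intCast, Real.norm_eq_abs, mul_pow, sq_abs]
    ring
  have hs0 : ∀ e : (Fin 3 → ℤ) → ℂ, 0 ≤ ∑ k ∈ s, ‖e k‖ ^ 2 := fun e => by positivity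
  calc ∫⁻ x, ENNReal.ofReal (|u x| + 4 * ∑ i, |du i x|) ^ 2 ∂torusMeasure
      ≤ ∫⁻ x, (4 * ‖u x‖ₑ ^ 2 + ∑ i, 64 * ‖du i x‖ₑ ^ 2) ∂torusMeasure := lintegral_mono hpt
    _ = 4 * ∫⁻ x, ‖u x‖ₑ ^ 2 ∂torusMeasure
        + ∑ i, 64 * ∫⁻ x, ‖du i x‖ₑ ^ 2 ∂torusMeasure := by
      rw [lintegral_add_left ((hm u).const_mul 4), lintegral_const_mul _ (hm u),
        lintegral_finsetSum _ fun i _ => (hm (du i)).const_mul 64]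
      simp only [lintegral_const_mul _ (hm _)]
    _ ≤ 4 * ENNReal.ofReal (∑ k ∈ s, ‖c k‖ ^ 2)
        + ∑ i, 64 * ENNReal.ofReal (∑ k ∈ s, ‖d i k‖ ^ 2) := by
      gcongr with i
      · exact lintegral_enorm_sq_sum_realMode_le s c
      · exact lintegral_enorm_sq_sum_realMode_le s (d i)
    _ = ENNReal.ofReal (4 * ∑ k ∈ s, ‖c k‖ ^ 2 + ∑ i, 64 * ∑ k ∈ s, ‖d i k‖ ^ 2) := by
      rw [ENNReal.ofReal_add (mul_nonneg (by norm_num) (hs0 c))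
          (Finset.sum_nonneg fun i _ => mul_nonneg (by norm_num) (hs0 (d i))),
        ENNReal.ofReal_sum_of_nonneg fun i _ => mul_nonneg (by norm_num) (hs0 (d i)),
        ENNReal.ofReal_mul (by norm_num)]
      simp [ENNReal.ofReal_mul]
    _ ≤ ENNReal.ofReal (sobolevConst * ∑ k ∈ s, (1 + freqSq k) * ‖c k‖ ^ 2) := by
      refine ENNReal.ofReal_le_ofReal ?_
      simp only [Finset.mul_sum]
      rw [Finset.sum_comm, ← Finset.sum_add_distrib]
      refine Finset.sum_le_sum fun k _ => ?_
      rw [← Finset.mul_sum]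
      simp only [hnd]
      rw [← Finset.sum_mul, ← Finset.mul_sum]
      change 4 * ‖c k‖ ^ 2 + 64 * (4 * Real.pi ^ 2 * freqSq k * ‖c k‖ ^ 2) ≤ _
      unfold sobolevConst
      have hpi : 1 ≤ Real.pi ^ 2 := one_le_pow₀ (by linarith [Real.pi_gt_three])
      nlinarith [mul_le_mul_of_nonneg_right hpi (sq_nonneg ‖c k‖), sq_nonneg ‖c k‖]

/-- **Sobolev embedding** `H¹(𝕋³) ⊆ L⁶(𝕋³)`. -/
lemma lintegral_pow_six_le (f : L2) :
    ∫⁻ x, ‖f x‖ₑ ^ 6 ∂torusMeasure ≤ (ENNReal.ofReal sobolevConst * h1Energy f) ^ 3 := by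
  set c := torusCoeff f
  set S : Finset (Fin 3 → ℤ) → C(Torus, ℝ) := fun s => ∑ k ∈ s, realMode (c k) k with hS
  -- Fatou's lemma along an almost everywhere convergent sequence of partial Fourier sums
  have hlim : Tendsto (fun s => ContinuousMap.toLp (E := ℝ) 2 torusMeasure ℝ (S s)) atTop
      (𝓝 f) := by
    have := hasSum_modeLp_torusCoeff f
    simpa only [HasSum, hS, map_sum, SummationFilter.unconditional_filter] using this
  obtain ⟨s, hs⟩ := exists_seq_tendsto (atTop : Filter (Finset (Fin 3 → ℤ)))
  obtain ⟨n, -, hn⟩ := (tendstoInMeasure_of_tendsto_Lp (hlim.comp hs)).exists_seq_tendsto_ae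
  have hae : ∀ᵐ x ∂torusMeasure, ‖f x‖ₑ ^ 6
      ≤ liminf (fun j => ‖S (s (n j)) x‖ₑ ^ 6) atTop := by
    have heq : ∀ᵐ x ∂torusMeasure, ∀ j,
        ContinuousMap.toLp (E := ℝ) 2 torusMeasure ℝ (S (s (n j))) x = S (s (n j)) x :=
      ae_all_iff.2 fun j => ContinuousMap.coeFn_toLp torusMeasure _
    filter_upwards [hn, heq] with x hx hx2
    have h1 : Tendsto (fun j => S (s (n j)) x) atTop (𝓝 (f x)) := by
      simpa only [Function.comp_apply, hx2] using hx
    have h2 := ((ENNReal.continuous_pow 6).tendsto _).comp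
      ((continuous_enorm.tendsto (f x)).comp h1)
    exact h2.liminf_eq.ge
  refine (lintegral_mono_ae hae).trans ((lintegral_liminf_le fun j =>
    (S (s (n j))).continuous.enorm.measurable.pow_const 6).trans ?_)
  refine liminf_le_of_frequently_le' (Frequently.of_forall fun j => ?_)
  refine (lintegral_pow_six_sum_realMode_le _ _).trans ?_
  have hC : 0 ≤ sobolevConst := by unfold sobolevConst; positivity
  rw [ENNReal.ofReal_mul hC]
  gcongr
  rw [ENNReal.ofReal_sum_of_nonneg fun k _ =>
    mul_nonneg (by linarith [freqSq_nonneg k]) (sq_nonneg _)]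
  exact ENNReal.sum_le_tsum _

/-! ### The cube as a locally Lipschitz map from `H¹` to `L²` -/

lemma h1Norm_eq_rpow (f : L2) : h1Norm f = h1Energy f ^ (1 / 2 : ℝ) := rfl

lemma memH1_iff {f : L2} : MemH1 f ↔ h1Energy f < ∞ := by
  rw [MemH1, h1Norm_eq_rpow, ENNReal.rpow_lt_top_iff_of_pos (by norm_num)]

lemma h1Energy_eq_sq (f : L2) : h1Energy f = h1Norm f ^ 2 := by
  rw [h1Norm_eq_rpow, ← ENNReal.rpow_natCast, ← ENNReal.rpow_mul]
  norm_num

lemma tendsto_h1Norm_zero_iff {α : Type*} {l : Filter α} {F : α → L2} :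
    Tendsto (fun a => h1Norm (F a)) l (𝓝 0) ↔ Tendsto (fun a => h1Energy (F a)) l (𝓝 0) := by
  constructor
  · intro h
    have h2 := ((ENNReal.continuous_pow 2).tendsto 0).comp h
    simpa [Function.comp_def, ← h1Energy_eq_sq] using h2
  · intro h
    have h2 := ((ENNReal.continuous_rpow_const (y := (1 / 2 : ℝ))).tendsto 0).comp h
    rw [ENNReal.zero_rpow_of_pos (by norm_num)] at h2
    exact h2

lemma h1Energy_eq_tsum_enorm (f : L2) :
    h1Energy f = ∑' k, ENNReal.ofReal (1 + freqSq k) * ‖torusCoeff f k‖ₑ ^ 2 := by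
  refine tsum_congr fun k => ?_
  rw [ENNReal.ofReal_mul (by linarith [freqSq_nonneg k]), ENNReal.ofReal_pow (norm_nonneg _),
    ofReal_norm]

lemma enorm_add_sq_le {E : Type*} [NormedAddCommGroup E] (a b : E) :
    ‖a + b‖ₑ ^ 2 ≤ 2 * ‖a‖ₑ ^ 2 + 2 * ‖b‖ₑ ^ 2 := by
  simp only [← ofReal_norm, ← ENNReal.ofReal_pow (norm_nonneg _)]
  rw [show (2 : ℝ≥0∞) = ENNReal.ofReal 2 by simp, ← ENNReal.ofReal_mul (by norm_num),
    ← ENNReal.ofReal_mul (by norm_num), ← ENNReal.ofReal_add (by positivity) (by positivity)]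
  refine ENNReal.ofReal_le_ofReal ?_
  have := norm_add_le a b
  nlinarith [sq_nonneg (‖a‖ - ‖b‖), norm_nonneg (a + b), norm_nonneg a, norm_nonneg b]

lemma h1Energy_add_le (f g : L2) : h1Energy (f + g) ≤ 2 * h1Energy f + 2 * h1Energy g := by
  simp only [h1Energy_eq_tsum_enorm, ← ENNReal.tsum_mul_left]
  rw [← ENNReal.tsum_add]
  refine ENNReal.tsum_le_tsum fun k => ?_
  rw [torusCoeff_add]
  refine (mul_le_mul_right (enorm_add_sq_le _ _) _).trans (le_of_eq ?_)
  ring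

lemma h1Energy_neg (f : L2) : h1Energy (-f) = h1Energy f := by
  simp only [h1Energy, ← coeffCLM_apply, map_neg, norm_neg]

lemma h1Energy_sub_le (f g : L2) : h1Energy (f - g) ≤ 2 * h1Energy f + 2 * h1Energy g := by
  rw [sub_eq_add_neg, ← h1Energy_neg g]
  exact h1Energy_add_le f (-g)

lemma memLp_cube {f : L2} (hf : MemH1 f) : MemLp (fun x => f x ^ 3) 2 torusMeasure := by
  refine ⟨(Lp.aestronglyMeasurable f).pow 3, ?_⟩
  rw [eLpNorm_eq_lintegral_rpow_enorm_toReal (by norm_num) (by norm_num)]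
  refine ENNReal.rpow_lt_top_of_nonneg (by norm_num) (ne_of_lt ?_)
  have h : ∫⁻ x, ‖f x ^ 3‖ₑ ^ (2 : ℝ≥0∞).toReal ∂torusMeasure
      = ∫⁻ x, ‖f x‖ₑ ^ 6 ∂torusMeasure := by
    refine lintegral_congr fun x => ?_
    rw [enorm_pow, ENNReal.toReal_ofNat, ENNReal.rpow_ofNat, ← pow_mul]
  rw [h]
  refine (lintegral_pow_six_le f).trans_lt ?_
  have := memH1_iff.1 hf
  exact ENNReal.pow_lt_top (ENNReal.mul_lt_top ENNReal.ofReal_lt_top this)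

lemma coeFn_cube {f : L2} (hf : MemH1 f) : cube f =ᵐ[torusMeasure] fun x => f x ^ 3 := by
  rw [cube, dif_pos (memLp_cube hf)]
  exact MemLp.coeFn_toLp _

lemma lintegral_sq_mul_pow_four_le (f g : L2) :
    ∫⁻ x, ‖f x‖ₑ ^ 2 * ‖g x‖ₑ ^ 4 ∂torusMeasure
      ≤ (ENNReal.ofReal sobolevConst * h1Energy f)
        * (ENNReal.ofReal sobolevConst * h1Energy g) ^ 2 := by
  have hf : AEMeasurable (fun x => ‖f x‖ₑ) torusMeasure := (Lp.aestronglyMeasurable f).enorm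
  have hg : AEMeasurable (fun x => ‖g x‖ₑ) torusMeasure := (Lp.aestronglyMeasurable g).enorm
  have hpq : Real.HolderConjugate 3 (3 / 2) := by
    rw [Real.holderConjugate_iff]; norm_num
  refine (ENNReal.lintegral_mul_le_Lp_mul_Lq torusMeasure hpq (hf.pow_const 2)
    (hg.pow_const 4)).trans ?_
  have h1 : ∀ z : ℝ≥0∞, (z ^ 2) ^ (3 : ℝ) = z ^ 6 := fun z => by
    rw [ENNReal.rpow_ofNat, ← pow_mul]
  have h2 : ∀ z : ℝ≥0∞, (z ^ 4) ^ (3 / 2 : ℝ) = z ^ 6 := fun z => by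
    rw [← ENNReal.rpow_natCast, ← ENNReal.rpow_mul, ← ENNReal.rpow_natCast]
    norm_num
  simp only [h1, h2]
  refine mul_le_mul' ?_ ?_
  · refine (ENNReal.rpow_le_rpow (lintegral_pow_six_le f) (by norm_num)).trans (le_of_eq ?_)
    rw [← ENNReal.rpow_natCast, ← ENNReal.rpow_mul]
    norm_num
  · refine (ENNReal.rpow_le_rpow (lintegral_pow_six_le g) (by norm_num)).trans (le_of_eq ?_)
    rw [← ENNReal.rpow_natCast, ← ENNReal.rpow_mul, ← ENNReal.rpow_natCast]
    norm_num

lemma enorm_cube_sub_cube_sq_le (a b : ℝ) :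
    ‖a ^ 3 - b ^ 3‖ₑ ^ 2 ≤ 5 * (‖a - b‖ₑ ^ 2 * ‖a‖ₑ ^ 4 + ‖a - b‖ₑ ^ 2 * ‖b‖ₑ ^ 4) := by
  simp only [Real.enorm_eq_ofReal_abs]
  rw [show (5 : ℝ≥0∞) = ENNReal.ofReal 5 by simp]
  simp only [← ENNReal.ofReal_pow (abs_nonneg _)]
  rw [← ENNReal.ofReal_mul (by positivity), ← ENNReal.ofReal_mul (by positivity),
    ← ENNReal.ofReal_add (by positivity) (by positivity), ← ENNReal.ofReal_mul (by positivity)]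
  refine ENNReal.ofReal_le_ofReal ?_
  rw [sq_abs, sq_abs, (by decide : Even 4).pow_abs, (by decide : Even 4).pow_abs, ← mul_add,
    show a ^ 3 - b ^ 3 = (a - b) * (a ^ 2 + a * b + b ^ 2) by ring, mul_pow]
  have h : (a ^ 2 + a * b + b ^ 2) ^ 2 ≤ 5 * (a ^ 4 + b ^ 4) := by
    nlinarith [sq_nonneg (a - b), sq_nonneg (a + b), sq_nonneg (a ^ 2 - b ^ 2),
      sq_nonneg (a ^ 2 + b ^ 2 - 2 * (a * b)), sq_nonneg (a ^ 2 - a * b), sq_nonneg (b ^ 2 - a * b)]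
  nlinarith [mul_le_mul_of_nonneg_left h (sq_nonneg (a - b))]

/-- The constant in the local Lipschitz bound `enorm_cube_sub_sq_le`. -/
def cubeConst : ℝ≥0∞ := 5 * ENNReal.ofReal sobolevConst ^ 3

lemma cubeConst_ne_top : cubeConst ≠ ∞ :=
  ENNReal.mul_ne_top (by norm_num) (ENNReal.pow_ne_top ENNReal.ofReal_ne_top)

/-- The cube is locally Lipschitz from `H¹(𝕋³)` to `L²(𝕋³)`, by Hölder's inequality and the
Sobolev embedding. -/
lemma enorm_cube_sub_sq_le {f g : L2} (hf : MemH1 f) (hg : MemH1 g) :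
    ‖cube f - cube g‖ₑ ^ 2
      ≤ cubeConst * (h1Energy f ^ 2 + h1Energy g ^ 2) * h1Energy (f - g) := by
  have hd : AEMeasurable (fun x => ‖(f - g) x‖ₑ) torusMeasure :=
    (Lp.aestronglyMeasurable (f - g)).enorm
  have hfm : AEMeasurable (fun x => ‖f x‖ₑ) torusMeasure := (Lp.aestronglyMeasurable f).enorm
  have hm : AEMeasurable (fun x => ‖(f - g) x‖ₑ ^ 2 * ‖f x‖ₑ ^ 4) torusMeasure :=
    (hd.pow_const 2).mul (hfm.pow_const 4)
  rw [enorm_sq_eq_lintegral]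
  have hae : ∀ᵐ x ∂torusMeasure, ‖(cube f - cube g) x‖ₑ ^ 2
      ≤ 5 * (‖(f - g) x‖ₑ ^ 2 * ‖f x‖ₑ ^ 4 + ‖(f - g) x‖ₑ ^ 2 * ‖g x‖ₑ ^ 4) := by
    filter_upwards [coeFn_cube hf, coeFn_cube hg, Lp.coeFn_sub (cube f) (cube g),
      Lp.coeFn_sub f g] with x h1 h2 h3 h4
    rw [h3, h4, Pi.sub_apply, Pi.sub_apply, h1, h2]
    exact enorm_cube_sub_cube_sq_le _ _
  refine (lintegral_mono_ae hae).trans ?_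
  rw [lintegral_const_mul' _ _ (by norm_num),
    lintegral_add_left' hm]
  refine (mul_le_mul_right (add_le_add (lintegral_sq_mul_pow_four_le (f - g) f)
    (lintegral_sq_mul_pow_four_le (f - g) g)) 5).trans (le_of_eq ?_)
  unfold cubeConst
  ring

/-- A curve in `C([0,T]; H¹)` is bounded in `H¹`. -/
lemma MemCH1.exists_h1Energy_le {T : ℝ} {w : ℝ → L2} (hw : MemCH1 T w) :
    ∃ M : ℝ≥0∞, M ≠ ∞ ∧ ∀ t ∈ Set.Icc 0 T, h1Energy (w t) ≤ M := by
  refine isCompact_Icc.induction_on (p := fun s => ∃ M : ℝ≥0∞, M ≠ ∞ ∧ ∀ t ∈ s, h1Energy (w t) ≤ M)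
    ⟨0, by simp, by simp⟩ ?_ ?_ ?_
  · rintro s t hst ⟨M, hM, h⟩
    exact ⟨M, hM, fun x hx => h x (hst hx)⟩
  · rintro s t ⟨M, hM, h⟩ ⟨N, hN, h'⟩
    refine ⟨max M N, (max_lt hM.lt_top hN.lt_top).ne, ?_⟩
    rintro x (hx | hx)
    · exact (h x hx).trans (le_max_left _ _)
    · exact (h' x hx).trans (le_max_right _ _)
  · intro t ht
    have h1 := tendsto_h1Norm_zero_iff.1 (hw.2 t ht)
    have h2 : ∀ᶠ s in 𝓝[Set.Icc 0 T] t, h1Energy (w s - w t) < 1 :=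
      h1.eventually_lt_const one_pos
    refine ⟨_, h2, 2 * 1 + 2 * h1Energy (w t), ?_, fun s hs => ?_⟩
    · have := (memH1_iff.1 (hw.1 t ht)).ne
      simp [ENNReal.mul_eq_top, this]
    · have h3 := h1Energy_add_le (w s - w t) (w t)
      rw [sub_add_cancel] at h3
      refine h3.trans ?_
      gcongr
      exact le_of_lt hs

/-! ### The heat semigroup under the time integral -/

lemma continuous_modeLp (k : Fin 3 → ℤ) : Continuous fun c : ℂ => modeLp c k := by
  simp only [← rePart_smul_characterLp]
  fun_prop

lemma aestronglyMeasurable_of_hasSum {ι α E : Type*} [Countable ι] [MeasurableSpace α]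
    [NormedAddCommGroup E] {μ : Measure α} {F : ι → α → E} {G : α → E}
    (hF : ∀ i, AEStronglyMeasurable (F i) μ) (h : ∀ᵐ a ∂μ, HasSum (fun i => F i a) (G a)) :
    AEStronglyMeasurable G μ := by
  refine aestronglyMeasurable_of_tendsto_ae (atTop : Filter (Finset ι))
    (f := fun s a => ∑ i ∈ s, F i a) (fun s => ?_) ?_
  · exact Finset.aestronglyMeasurable_fun_sum s fun i _ => hF i
  · filter_upwards [h] with a ha
    simpa only [HasSum, SummationFilter.unconditional_filter] using ha

lemma aestronglyMeasurable_heat {m t : ℝ} {G : ℝ → L2} {S : Set ℝ} (hS : MeasurableSet S)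
    (hSt : ∀ s ∈ S, s ≤ t) (hG : AEStronglyMeasurable G (volume.restrict S)) :
    AEStronglyMeasurable (fun s => heat m (t - s) (G s)) (volume.restrict S) := by
  refine aestronglyMeasurable_of_hasSum
    (F := fun k s => Real.exp (-(t - s) * symbol m k) • modeLp (torusCoeff (G s) k) k)
    (fun k => ?_) ?_
  · have hexp : Continuous fun s : ℝ => Real.exp (-(t - s) * symbol m k) := by fun_prop
    refine hexp.aestronglyMeasurable.smul ?_
    refine (continuous_modeLp k).comp_aestronglyMeasurable ?_
    simp only [← coeffCLM_apply]
    exact (coeffCLM k).continuous.comp_aestronglyMeasurable hG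
  · filter_upwards [ae_restrict_mem hS] with s hs
    exact hasSum_heat (sub_nonneg.2 (hSt s hs)) (G s)

lemma intervalIntegrable_heat {m t : ℝ} (ht : 0 ≤ t) {G : ℝ → L2}
    (hG : IntegrableOn G (Set.Ioc 0 t)) :
    IntervalIntegrable (fun s => heat m (t - s) (G s)) volume 0 t := by
  rw [intervalIntegrable_iff_integrableOn_Ioc_of_le ht]
  refine Integrable.mono hG
    (aestronglyMeasurable_heat measurableSet_Ioc (fun s hs => hs.2) hG.aestronglyMeasurable) ?_
  filter_upwards [ae_restrict_mem measurableSet_Ioc] with s hs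
  exact norm_heat_le (sub_nonneg.2 hs.2) (G s)

lemma torusCoeff_intervalIntegral {a b : ℝ} {F : ℝ → L2}
    (hF : IntervalIntegrable F volume a b) (k : Fin 3 → ℤ) :
    torusCoeff (∫ s in a..b, F s) k = ∫ s in a..b, torusCoeff (F s) k := by
  simp only [← coeffCLM_apply]
  exact ((coeffCLM k).intervalIntegral_comp_comm hF).symm

lemma lintegral_exp_sq_le {μ : ℝ} (hμ : 0 < μ) {t : ℝ} (ht : 0 ≤ t) :
    ∫⁻ s in Set.Ioc 0 t, ENNReal.ofReal (Real.exp (-(t - s) * μ)) ^ 2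
      ≤ ENNReal.ofReal (1 / (2 * μ)) := by
  simp only [← ENNReal.ofReal_pow (Real.exp_nonneg _)]
  have hc : Continuous fun s : ℝ => Real.exp (-(t - s) * μ) ^ 2 := by fun_prop
  rw [← ofReal_integral_eq_lintegral_ofReal hc.integrableOn_Ioc
    (ae_of_all _ fun s => by positivity), ← intervalIntegral.integral_of_le ht]
  refine ENNReal.ofReal_le_ofReal ?_
  have hd : ∀ s, HasDerivAt (fun s : ℝ => Real.exp (-(t - s) * μ) ^ 2 / (2 * μ))
      (Real.exp (-(t - s) * μ) ^ 2) s := by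
    intro s
    have h1 : HasDerivAt (fun s : ℝ => -(t - s) * μ) μ s := by
      simpa using (((hasDerivAt_id s).const_sub t).neg).mul_const μ
    convert! (h1.exp.pow 2).div_const (2 * μ) using 1
    field_simp
    simp [mul_comm]
  rw [intervalIntegral.integral_eq_sub_of_hasDerivAt (fun s _ => hd s)
    (hc.intervalIntegrable 0 t)]
  simp only [sub_self, neg_zero, zero_mul, Real.exp_zero, one_pow]
  have : 0 ≤ Real.exp (-(t - 0) * μ) ^ 2 / (2 * μ) := by positivity
  linarith

/-! ### The explicit control and its trajectory -/

/-- The symbol of the operator that maps the target to the linear control at the time `s`. -/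
def controlSymbol (m T s : ℝ) (k : Fin 3 → ℤ) : ℝ :=
  (1 / T + 2 * s / T * symbol m k) * Real.exp (-(T - s) * symbol m k)

/-- The control `(1/T + (2s/T) (m² - Δ)) e^{(T-s)(Δ-m²)} φ`, which drives the linear equation
along `s ↦ (s/T) e^{(T-s)(Δ-m²)} φ`. For `s ≥ T` the series need not converge. -/
def control (m T : ℝ) (φ : L2) (s : ℝ) : L2 :=
  ∑' k, controlSymbol m T s k • modeLp (torusCoeff φ k) k

lemma controlSymbol_nonneg {m T s : ℝ} (hT : 0 < T) (hs : 0 ≤ s) (k : Fin 3 → ℤ) :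
    0 ≤ controlSymbol m T s k := by
  have := symbol_nonneg m k
  unfold controlSymbol
  positivity

lemma controlSymbol_le {m T s : ℝ} (hT : 0 < T) (hs : s ∈ Set.Ico 0 T) (k : Fin 3 → ℤ) :
    controlSymbol m T s k ≤ 1 / T + 2 / (T - s) := by
  have hμ := symbol_nonneg m k
  have hτ : 0 < T - s := sub_pos.2 hs.2
  set μ := symbol m k
  have h1 : s / T ≤ 1 := (div_le_one hT).2 hs.2.le
  -- this is `y e^{-y} ≤ 1` for `y = (T - s) μ`
  have h2 : μ * Real.exp (-(T - s) * μ) ≤ 1 / (T - s) := by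
    rw [le_div_iff₀ hτ]
    have h3 : (T - s) * μ ≤ Real.exp ((T - s) * μ) := by
      linarith [Real.add_one_le_exp ((T - s) * μ)]
    have h4 : Real.exp ((T - s) * μ) * Real.exp (-(T - s) * μ) = 1 := by
      rw [← Real.exp_add, neg_mul, add_neg_cancel, Real.exp_zero]
    nlinarith [mul_le_mul_of_nonneg_right h3 (Real.exp_nonneg (-(T - s) * μ))]
  have h5 : Real.exp (-(T - s) * μ) ≤ 1 := exp_symbol_le_one hτ.le k
  calc controlSymbol m T s k
      = 1 / T * Real.exp (-(T - s) * μ) + 2 * (s / T) * (μ * Real.exp (-(T - s) * μ)) := by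
        unfold controlSymbol; ring
    _ ≤ 1 / T * 1 + 2 * 1 * (1 / (T - s)) := by
        have : 0 ≤ s / T := div_nonneg hs.1 hT.le
        gcongr
    _ = 1 / T + 2 / (T - s) := by ring

/-- For `s < T` the defining series of the control converges, with the expected coefficients. -/
lemma control_spec {m T s : ℝ} (hT : 0 < T) (hs : s ∈ Set.Ico 0 T) (φ : L2) :
    HasSum (fun k => controlSymbol m T s k • modeLp (torusCoeff φ k) k) (control m T φ s) ∧
      ∀ k, torusCoeff (control m T φ s) k = controlSymbol m T s k * torusCoeff φ k := by
  obtain ⟨g, hg, hgc⟩ := exists_hasSum_multiplier (controlSymbol m T s)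
    (fun k => by simp [controlSymbol]) φ (by
      refine Summable.of_nonneg_of_le (fun k => by positivity) (fun k => ?_)
        ((hasSum_sq_torusCoeff φ).summable.mul_left ((1 / T + 2 / (T - s)) ^ 2))
      have := controlSymbol_nonneg (m := m) hT hs.1 k
      gcongr
      exact controlSymbol_le hT hs k)
  have : control m T φ s = g := hg.tsum_eq
  rw [this]
  exact ⟨hg, hgc⟩

/-- The singular time `T` of the control is a null set. -/
lemma ae_restrict_Ioc_mem_Ico (t : ℝ) {T : ℝ} (ht : t ≤ T) :
    ∀ᵐ s ∂volume.restrict (Set.Ioc 0 t), s ∈ Set.Ico 0 T := by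
  filter_upwards [ae_restrict_mem measurableSet_Ioc, Measure.ae_ne (volume.restrict _) T]
    with s hs hsT
  exact ⟨hs.1.le, lt_of_le_of_ne (hs.2.trans ht) hsT⟩

lemma aestronglyMeasurable_control (m : ℝ) {T : ℝ} (hT : 0 < T) (φ : L2) :
    AEStronglyMeasurable (control m T φ) (volume.restrict (Set.Ioc 0 T)) := by
  refine aestronglyMeasurable_of_hasSum
    (F := fun k s => controlSymbol m T s k • modeLp (torusCoeff φ k) k) (fun k => ?_) ?_
  · refine Continuous.aestronglyMeasurable ?_
    unfold controlSymbol
    fun_prop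
  · filter_upwards [ae_restrict_Ioc_mem_Ico T le_rfl] with s hs
    exact (control_spec hT hs φ).1

lemma one_add_freqSq_le {m : ℝ} (hm : 0 < m) (k : Fin 3 → ℤ) :
    1 + freqSq k ≤ (1 / m ^ 2 + 1) * symbol m k := by
  have hf := freqSq_nonneg k
  have hpi : 1 ≤ Real.pi ^ 2 := one_le_pow₀ (by linarith [Real.pi_gt_three])
  have h1 : freqSq k ≤ 4 * Real.pi ^ 2 * freqSq k := by nlinarith
  have h2 : 0 < 1 / m ^ 2 := by positivity
  have h3 : 1 / m ^ 2 * m ^ 2 = 1 := by field_simp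
  unfold symbol
  nlinarith [mul_nonneg h2.le (hf.trans h1), sq_nonneg m]

/-- Each mode of the control costs `(1/T + 2λ)² / (2λ)`, up to a constant, where `λ` is the symbol.
This is of the order of `1 + |k|²`, so that `φ ∈ H¹` is just enough. -/
lemma memL2L2_control {m T : ℝ} (hm : 0 < m) (hT : 0 < T) {φ : L2} (hφ : MemH1 φ) :
    MemL2L2 T (control m T φ) := by
  rw [MemL2L2, ← Measure.restrict_congr_set Ioc_ae_eq_Icc]
  refine ⟨aestronglyMeasurable_control m hT φ, ?_⟩
  rw [eLpNorm_eq_lintegral_rpow_enorm_toReal (by norm_num) (by norm_num)]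
  refine ENNReal.rpow_lt_top_of_nonneg (by norm_num) (ne_of_lt ?_)
  simp only [ENNReal.toReal_ofNat, ENNReal.rpow_ofNat]
  set C : ℝ := 1 / (T ^ 2 * m ^ 2) + 4 * (4 * Real.pi ^ 2 + m ^ 2) with hC
  have hbound : ∀ k, (2 / T ^ 2 + 8 * symbol m k ^ 2) * (1 / (2 * symbol m k))
      ≤ C * (1 + freqSq k) := by
    intro k
    have hμ := symbol_pos hm k
    have hf := freqSq_nonneg k
    have h1 : (2 / T ^ 2 + 8 * symbol m k ^ 2) * (1 / (2 * symbol m k))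
        = 1 / (T ^ 2 * symbol m k) + 4 * symbol m k := by
      field_simp
      ring
    have h2 : m ^ 2 ≤ symbol m k := by
      unfold symbol
      linarith [mul_nonneg (sq_nonneg Real.pi) hf]
    have h3 : 1 / (T ^ 2 * symbol m k) ≤ 1 / (T ^ 2 * m ^ 2) := by gcongr
    have h4 : symbol m k ≤ (4 * Real.pi ^ 2 + m ^ 2) * (1 + freqSq k) := by
      unfold symbol
      nlinarith [sq_nonneg Real.pi, mul_nonneg (sq_nonneg m) hf]
    have h5 : 0 ≤ 1 / (T ^ 2 * m ^ 2) := by positivity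
    rw [h1, hC]
    nlinarith [mul_nonneg h5 hf]
  calc ∫⁻ s in Set.Ioc 0 T, ‖control m T φ s‖ₑ ^ 2
      ≤ ∫⁻ s in Set.Ioc 0 T, ∑' k, ENNReal.ofReal ((2 / T ^ 2 + 8 * symbol m k ^ 2) *
          ‖torusCoeff φ k‖ ^ 2) * ENNReal.ofReal (Real.exp (-(T - s) * symbol m k)) ^ 2 := by
        refine lintegral_mono_ae ?_
        filter_upwards [ae_restrict_Ioc_mem_Ico T le_rfl] with s hs
        rw [enorm_sq_eq_tsum]
        refine ENNReal.tsum_le_tsum fun k => ?_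
        have hμ := symbol_nonneg m k
        rw [(control_spec hT hs φ).2 k, ← ofReal_norm, ← ENNReal.ofReal_pow (norm_nonneg _),
          ← ENNReal.ofReal_pow (Real.exp_nonneg _), ← ENNReal.ofReal_mul (by positivity)]
        refine ENNReal.ofReal_le_ofReal ?_
        rw [norm_mul, Complex.norm_real, mul_pow, Real.norm_eq_abs, sq_abs, controlSymbol,
          mul_pow]
        have hsT : s / T ≤ 1 := (div_le_one hT).2 hs.2.le
        have hs0 : 0 ≤ s / T := div_nonneg hs.1 hT.le
        have h1 : 1 / T + 2 * s / T * symbol m k ≤ 1 / T + 2 * symbol m k := by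
          have : 2 * s / T * symbol m k = 2 * (s / T * symbol m k) := by ring
          rw [this]
          nlinarith [mul_le_mul_of_nonneg_right hsT hμ]
        have h0 : 0 ≤ 1 / T + 2 * s / T * symbol m k := by
          have := hs.1
          positivity
        have h2 : (1 / T + 2 * s / T * symbol m k) ^ 2 ≤ 2 / T ^ 2 + 8 * symbol m k ^ 2 := by
          refine (pow_le_pow_left₀ h0 h1 2).trans ?_
          have h3 : 2 / T ^ 2 = 2 * (1 / T) ^ 2 := by ring
          rw [h3]
          nlinarith [sq_nonneg (1 / T - 2 * symbol m k)]
        calc _ ≤ (2 / T ^ 2 + 8 * symbol m k ^ 2) * Real.exp (-(T - s) * symbol m k) ^ 2 *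
              ‖torusCoeff φ k‖ ^ 2 := by gcongr
          _ = _ := by ring
    _ = ∑' k, ENNReal.ofReal ((2 / T ^ 2 + 8 * symbol m k ^ 2) * ‖torusCoeff φ k‖ ^ 2) *
          ∫⁻ s in Set.Ioc 0 T, ENNReal.ofReal (Real.exp (-(T - s) * symbol m k)) ^ 2 := by
        have hmeas : ∀ k, Measurable fun s : ℝ =>
            ENNReal.ofReal (Real.exp (-(T - s) * symbol m k)) ^ 2 := fun k => by fun_prop
        rw [lintegral_tsum fun k => ((hmeas k).const_mul _).aemeasurable]
        simp only [lintegral_const_mul _ (hmeas _)]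
    _ ≤ ∑' k, ENNReal.ofReal C *
          ENNReal.ofReal ((1 + freqSq k) * ‖torusCoeff φ k‖ ^ 2) := by
        refine ENNReal.tsum_le_tsum fun k => ?_
        have hμ := symbol_pos hm k
        refine (mul_le_mul_right (lintegral_exp_sq_le hμ hT.le) _).trans ?_
        rw [← ENNReal.ofReal_mul (by positivity), ← ENNReal.ofReal_mul (by positivity)]
        refine ENNReal.ofReal_le_ofReal ?_
        have := mul_le_mul_of_nonneg_right (hbound k) (sq_nonneg ‖torusCoeff φ k‖)
        linarith
    _ = ENNReal.ofReal C * h1Energy φ := by rw [ENNReal.tsum_mul_left]; rfl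
    _ < ∞ := ENNReal.mul_lt_top ENNReal.ofReal_lt_top (memH1_iff.1 hφ)

/-- The curve `t ↦ (t/T) e^{(T-t)(Δ-m²)} φ` from `0` to `φ`. -/
def trajectory (m T : ℝ) (φ : L2) (t : ℝ) : L2 := (t / T) • heat m (T - t) φ

/-- The symbol of the operator that maps `φ` to `trajectory m T φ t`. -/
def trajectorySymbol (m T t : ℝ) (k : Fin 3 → ℤ) : ℝ :=
  t / T * Real.exp (-(T - t) * symbol m k)

lemma torusCoeff_trajectory {m T t : ℝ} (ht : t ≤ T) (φ : L2) (k : Fin 3 → ℤ) :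
    torusCoeff (trajectory m T φ t) k = trajectorySymbol m T t k * torusCoeff φ k := by
  rw [trajectory, torusCoeff_smul, torusCoeff_heat (sub_nonneg.2 ht), trajectorySymbol]
  push_cast
  ring

lemma trajectorySymbol_mem_Icc {m T t : ℝ} (hT : 0 < T) (ht : t ∈ Set.Icc 0 T)
    (k : Fin 3 → ℤ) : trajectorySymbol m T t k ∈ Set.Icc 0 1 := by
  have h1 : 0 ≤ t / T := div_nonneg ht.1 hT.le
  have h2 : t / T ≤ 1 := (div_le_one hT).2 ht.2
  have h3 := Real.exp_nonneg (-(T - t) * symbol m k)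
  have h4 := exp_symbol_le_one (m := m) (sub_nonneg.2 ht.2) k
  exact ⟨mul_nonneg h1 h3, mul_le_one₀ h2 h3 h4⟩

lemma MemH1.summable {φ : L2} (hφ : MemH1 φ) :
    Summable fun k => (1 + freqSq k) * ‖torusCoeff φ k‖ ^ 2 := by
  have h := ENNReal.summable_toReal (memH1_iff.1 hφ).ne
  refine h.congr fun k => ?_
  rw [ENNReal.toReal_ofReal]
  have := freqSq_nonneg k
  positivity

lemma memCH1_trajectory {m T : ℝ} (hT : 0 < T) {φ : L2} (hφ : MemH1 φ) :
    MemCH1 T (trajectory m T φ) := by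
  have hA0 : ∀ k, 0 ≤ (1 + freqSq k) * ‖torusCoeff φ k‖ ^ 2 := fun k => by
    have := freqSq_nonneg k
    positivity
  refine ⟨fun t ht => ?_, fun t ht => ?_⟩
  · refine memH1_iff.2 (lt_of_le_of_lt (ENNReal.tsum_le_tsum fun k => ?_) (memH1_iff.1 hφ))
    refine ENNReal.ofReal_le_ofReal ?_
    have h1 := trajectorySymbol_mem_Icc (m := m) hT ht k
    have h2 : ‖torusCoeff (trajectory m T φ t) k‖ ≤ ‖torusCoeff φ k‖ := by
      rw [torusCoeff_trajectory ht.2, norm_mul, Complex.norm_real, Real.norm_eq_abs,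
        abs_of_nonneg h1.1]
      exact mul_le_of_le_one_left (norm_nonneg _) h1.2
    have := freqSq_nonneg k
    gcongr
  · rw [tendsto_h1Norm_zero_iff]
    set A : (Fin 3 → ℤ) → ℝ := fun k => (1 + freqSq k) * ‖torusCoeff φ k‖ ^ 2 with hA
    set a := trajectorySymbol m T with ha
    have hdiff : ∀ s ∈ Set.Icc 0 T, ∀ k, (a s k - a t k) ^ 2 ≤ 1 := by
      intro s hs k
      have h1 := trajectorySymbol_mem_Icc (m := m) hT hs k
      have h2 := trajectorySymbol_mem_Icc (m := m) hT ht k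
      rw [sq_le_one_iff_abs_le_one, abs_le]
      constructor <;> linarith [h1.1, h1.2, h2.1, h2.2]
    have hle : ∀ s ∈ Set.Icc 0 T, ∀ k, (a s k - a t k) ^ 2 * A k ≤ A k := fun s hs k =>
      mul_le_of_le_one_left (hA0 k) (hdiff s hs k)
    have hnn : ∀ s k, 0 ≤ (a s k - a t k) ^ 2 * A k := fun s k =>
      mul_nonneg (sq_nonneg _) (hA0 k)
    have hlim : Tendsto (fun s => ∑' k, (a s k - a t k) ^ 2 * A k) (𝓝[Set.Icc 0 T] t)
        (𝓝 (∑' _ : Fin 3 → ℤ, (0 : ℝ))) := by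
      refine tendsto_tsum_of_dominated_convergence (bound := A) hφ.summable (fun k => ?_) ?_
      · have hc : Continuous fun s => (a s k - a t k) ^ 2 * A k := by
          simp only [ha, trajectorySymbol]
          fun_prop
        have := (hc.tendsto t).mono_left (nhdsWithin_le_nhds (s := Set.Icc 0 T))
        simpa using this
      · filter_upwards [self_mem_nhdsWithin] with s hs k
        rw [Real.norm_of_nonneg (hnn s k)]
        exact hle s hs k
    rw [tsum_zero] at hlim
    have hlim2 := (ENNReal.continuous_ofReal.tendsto 0).comp hlim
    rw [ENNReal.ofReal_zero] at hlim2
    refine hlim2.congr' ?_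
    filter_upwards [self_mem_nhdsWithin] with s hs
    rw [Function.comp_apply, ENNReal.ofReal_tsum_of_nonneg (hnn s)
      (Summable.of_nonneg_of_le (hnn s) (hle s hs) hφ.summable), h1Energy]
    refine tsum_congr fun k => ?_
    rw [torusCoeff_sub, torusCoeff_trajectory hs.2, torusCoeff_trajectory ht.2, ← sub_mul,
      norm_mul, ← Complex.ofReal_sub, Complex.norm_real, mul_pow, Real.norm_eq_abs, sq_abs]
    congr 1
    simp only [hA, ha]
    ring

/-- The cube of a curve in `C([0,T]; H¹)` lies in `C([0,T]; L²)`. -/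
lemma continuousOn_cube {T : ℝ} {w : ℝ → L2} (hw : MemCH1 T w) :
    ContinuousOn (fun t => cube (w t)) (Set.Icc 0 T) := by
  obtain ⟨M, hM, hMw⟩ := hw.exists_h1Energy_le
  intro t ht
  rw [ContinuousWithinAt, tendsto_iff_edist_tendsto_0]
  have h1 := tendsto_h1Norm_zero_iff.1 (hw.2 t ht)
  have hK : cubeConst * (M ^ 2 + M ^ 2) ≠ ∞ :=
    ENNReal.mul_ne_top cubeConst_ne_top (by simp [hM])
  have h2 := ENNReal.Tendsto.const_mul h1 (Or.inr hK)
  have h3 := ((ENNReal.continuous_rpow_const (y := (1 / 2 : ℝ))).tendsto _).comp h2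
  rw [mul_zero, ENNReal.zero_rpow_of_pos (by norm_num)] at h3
  refine tendsto_of_tendsto_of_tendsto_of_le_of_le' tendsto_const_nhds h3
    (Eventually.of_forall fun _ => zero_le) ?_
  filter_upwards [self_mem_nhdsWithin] with s hs
  have h4 := enorm_cube_sub_sq_le (hw.1 s hs) (hw.1 t ht)
  have h5 : ‖cube (w s) - cube (w t)‖ₑ ^ 2
      ≤ cubeConst * (M ^ 2 + M ^ 2) * h1Energy (w s - w t) := by
    refine h4.trans ?_
    gcongr
    · exact hMw s hs
    · exact hMw t ht
  rw [edist_eq_enorm_sub, Function.comp_apply]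
  refine le_trans (le_of_eq ?_) (ENNReal.rpow_le_rpow h5 (by norm_num))
  rw [← ENNReal.rpow_natCast, ← ENNReal.rpow_mul]
  norm_num

lemma memL2L2_cube {T : ℝ} {w : ℝ → L2} (hw : MemCH1 T w) :
    MemL2L2 T fun t => cube (w t) := by
  obtain ⟨C, hC⟩ := isCompact_Icc.exists_bound_of_continuousOn (continuousOn_cube hw)
  refine MemLp.of_bound ((continuousOn_cube hw).aestronglyMeasurable measurableSet_Icc) C ?_
  filter_upwards [ae_restrict_mem measurableSet_Icc] with t ht
  exact hC t ht

/-- Mode by mode, the control is the driver of the linear equation along the trajectory. -/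
lemma hasDerivAt_exp_mul_trajectorySymbol {m T t : ℝ} (k : Fin 3 → ℤ) (s : ℝ) :
    HasDerivAt (fun s => Real.exp (-(t - s) * symbol m k) * trajectorySymbol m T s k)
      (Real.exp (-(t - s) * symbol m k) * controlSymbol m T s k) s := by
  have h1 : ∀ r : ℝ, HasDerivAt (fun s : ℝ => Real.exp (-(r - s) * symbol m k))
      (Real.exp (-(r - s) * symbol m k) * symbol m k) s := by
    intro r
    refine HasDerivAt.exp ?_
    simpa using (((hasDerivAt_id s).const_sub r).neg).mul_const (symbol m k)
  have h2 := (h1 t).mul (((hasDerivAt_id s).div_const T).mul (h1 T))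
  convert! h2 using 1
  simp only [controlSymbol, id, Pi.mul_apply]
  ring

lemma trajectory_eq_integral {m T t : ℝ} (hT : 0 < T) (ht : t ∈ Set.Icc 0 T) {φ : L2}
    (hint : IntervalIntegrable (fun s => heat m (t - s) (control m T φ s)) volume 0 t) :
    trajectory m T φ t = ∫ s in (0 : ℝ)..t, heat m (t - s) (control m T φ s) := by
  refine ext_torusCoeff fun k => ?_
  rw [torusCoeff_trajectory ht.2, torusCoeff_intervalIntegral hint]
  have h1 : ∫ s in (0 : ℝ)..t, torusCoeff (heat m (t - s) (control m T φ s)) k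
      = ∫ s in (0 : ℝ)..t, ((Real.exp (-(t - s) * symbol m k) * controlSymbol m T s k : ℝ) : ℂ)
          * torusCoeff φ k := by
    rw [intervalIntegral.integral_of_le ht.1, intervalIntegral.integral_of_le ht.1]
    refine integral_congr_ae ?_
    filter_upwards [ae_restrict_mem measurableSet_Ioc, ae_restrict_Ioc_mem_Ico t ht.2]
      with s hs hsT
    rw [torusCoeff_heat (sub_nonneg.2 hs.2), (control_spec hT hsT φ).2 k]
    push_cast
    ring
  have hc : Continuous fun s => Real.exp (-(t - s) * symbol m k) * controlSymbol m T s k := by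
    unfold controlSymbol
    fun_prop
  rw [h1, intervalIntegral.integral_mul_const, intervalIntegral.integral_ofReal,
    intervalIntegral.integral_eq_sub_of_hasDerivAt
      (fun s _ => hasDerivAt_exp_mul_trajectorySymbol k s) (hc.intervalIntegrable 0 t)]
  simp [trajectorySymbol]

/-- The driver is the linear control plus the cube of the trajectory, so that the nonlinearity
cancels along the trajectory. -/
lemma isMildSolution_trajectory {m T : ℝ} (hm : 0 < m) (hT : 0 < T) {φ : L2} (hφ : MemH1 φ) :
    IsMildSolution m T (fun s => control m T φ s + cube (trajectory m T φ s)) 0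
      (trajectory m T φ) := by
  have hint : ∀ t ∈ Set.Icc 0 T,
      IntervalIntegrable (fun s => heat m (t - s) (control m T φ s)) volume 0 t := by
    intro t ht
    refine intervalIntegrable_heat ht.1 ?_
    have h1 : IntegrableOn (control m T φ) (Set.Icc 0 T) :=
      MemLp.integrable (by norm_num) (memL2L2_control hm hT hφ)
    exact h1.mono_set ((Set.Ioc_subset_Icc_self).trans (Set.Icc_subset_Icc_right ht.2))
  refine ⟨memCH1_trajectory hT hφ, fun t ht => ?_, fun t ht => ?_⟩
  · simpa only [add_sub_cancel_right] using hint t ht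
  · simp only [add_sub_cancel_right]
    rw [heat_zero ht.1, zero_add]
    exact trajectory_eq_integral hT ht (hint t ht)

lemma trajectory_end {m T : ℝ} (hT : 0 < T) (φ : L2) : trajectory m T φ T = φ := by
  refine ext_torusCoeff fun k => ?_
  simp [torusCoeff_trajectory le_rfl, trajectorySymbol, hT.ne']

/-! ### Uniqueness of mild solutions -/

/-- A bounded solution of the homogeneous Gronwall inequality vanishes; no measurability of `y`
is needed. -/
lemma eq_zero_of_le_mul_lintegral {T : ℝ} {y : ℝ → ℝ≥0∞} {K B : ℝ≥0∞} (hK : K ≠ ∞) (hB : B ≠ ∞)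
    (hyB : ∀ t ∈ Set.Icc 0 T, y t ≤ B)
    (hy : ∀ t ∈ Set.Icc 0 T, y t ≤ K * ∫⁻ s in Set.Ioc 0 t, y s) :
    ∀ t ∈ Set.Icc 0 T, y t = 0 := by
  lift K to NNReal using hK
  lift B to NNReal using hB
  have key : ∀ n : ℕ, ∀ t ∈ Set.Icc 0 T,
      y t ≤ ENNReal.ofReal (B * ((K * t) ^ n / n.factorial)) := by
    intro n
    induction n with
    | zero => intro t ht; simpa using hyB t ht
    | succ n ih =>
      intro t ht
      have hc : Continuous fun s : ℝ => (B : ℝ) * ((K * s) ^ n / n.factorial) := by fun_prop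
      calc y t ≤ K * ∫⁻ s in Set.Ioc 0 t, y s := hy t ht
        _ ≤ K * ∫⁻ s in Set.Ioc 0 t, ENNReal.ofReal (B * ((K * s) ^ n / n.factorial)) := by
          refine mul_le_mul_right (lintegral_mono_ae ?_) _
          filter_upwards [ae_restrict_mem measurableSet_Ioc] with s hs
          exact ih s ⟨hs.1.le, hs.2.trans ht.2⟩
        _ = ENNReal.ofReal K * ENNReal.ofReal
              (∫ s in (0 : ℝ)..t, (B : ℝ) * ((K * s) ^ n / n.factorial)) := by
          rw [intervalIntegral.integral_of_le ht.1,
            ofReal_integral_eq_lintegral_ofReal hc.integrableOn_Ioc, ENNReal.ofReal_coe_nnreal]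
          filter_upwards [ae_restrict_mem measurableSet_Ioc] with s hs
          have := hs.1.le
          positivity
        _ = ENNReal.ofReal (B * ((K * t) ^ (n + 1) / (n + 1).factorial)) := by
          rw [← ENNReal.ofReal_mul K.coe_nonneg]
          congr 1
          simp only [mul_pow, intervalIntegral.integral_const_mul, intervalIntegral.integral_div,
            integral_pow, Nat.factorial_succ]
          push_cast
          field_simp
          simp only [zero_pow (Nat.succ_ne_zero n), sub_zero]
          ring
  intro t ht
  have h1 := (FloorSemiring.tendsto_pow_div_factorial_atTop ((K : ℝ) * t)).const_mul (B : ℝ)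
  have h2 := (ENNReal.continuous_ofReal.tendsto _).comp h1
  rw [mul_zero, ENNReal.ofReal_zero] at h2
  exact le_antisymm (ge_of_tendsto' h2 fun n => key n t ht) zero_le

/-- The energy estimate for the linear equation: `L²` forcing controls the `H¹` norm. -/
lemma h1Energy_integral_heat_le {m t : ℝ} (hm : 0 < m) (ht : 0 ≤ t) {N : ℝ → L2}
    (hN : IntervalIntegrable (fun s => heat m (t - s) (N s)) volume 0 t) :
    h1Energy (∫ s in (0 : ℝ)..t, heat m (t - s) (N s))
      ≤ ENNReal.ofReal (1 / m ^ 2 + 1) * ∫⁻ s in Set.Ioc 0 t, ‖N s‖ₑ ^ 2 := by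
  set μ := volume.restrict (Set.Ioc 0 t) with hμ
  set e : (Fin 3 → ℤ) → ℝ → ℝ := fun k s => Real.exp (-(t - s) * symbol m k) with he
  have hcoeff : ∀ k, ∀ᵐ s ∂μ, torusCoeff (heat m (t - s) (N s)) k
      = (e k s : ℂ) * torusCoeff (N s) k := by
    intro k
    filter_upwards [ae_restrict_mem measurableSet_Ioc] with s hs
    exact torusCoeff_heat (sub_nonneg.2 hs.2) _ _
  -- `N` itself is not assumed measurable: its coefficients are recovered from those of
  -- `heat m (t - s) (N s)` by multiplying with the inverse exponential
  have hmeas : ∀ k, AEStronglyMeasurable (fun s => torusCoeff (N s) k) μ := by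
    intro k
    have h1 : AEStronglyMeasurable (fun s => torusCoeff (heat m (t - s) (N s)) k) μ := by
      simp only [← coeffCLM_apply]
      exact (coeffCLM k).continuous.comp_aestronglyMeasurable hN.1.aestronglyMeasurable
    have h2 : Continuous fun s => ((Real.exp ((t - s) * symbol m k) : ℝ) : ℂ) := by fun_prop
    refine (h2.aestronglyMeasurable.mul h1).congr ?_
    filter_upwards [hcoeff k] with s hs
    rw [Pi.mul_apply, hs, ← mul_assoc, ← Complex.ofReal_mul]
    simp only [he]
    rw [← Real.exp_add, neg_mul, add_neg_cancel, Real.exp_zero, Complex.ofReal_one, one_mul]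
  -- Cauchy–Schwarz in time gains the factor `1 / (2 * symbol m k)`, which pays for `1 + |k|²`
  have hsq : ∀ k, ‖torusCoeff (∫ s in (0 : ℝ)..t, heat m (t - s) (N s)) k‖ₑ ^ 2
      ≤ ENNReal.ofReal (1 / (2 * symbol m k)) * ∫⁻ s, ‖torusCoeff (N s) k‖ₑ ^ 2 ∂μ := by
    intro k
    have hem : AEMeasurable (fun s => ENNReal.ofReal (e k s)) μ := by
      have : Measurable fun s => ENNReal.ofReal (e k s) := by fun_prop
      exact this.aemeasurable
    have h1 : ‖torusCoeff (∫ s in (0 : ℝ)..t, heat m (t - s) (N s)) k‖ₑ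
        ≤ ∫⁻ s, ENNReal.ofReal (e k s) * ‖torusCoeff (N s) k‖ₑ ∂μ := by
      rw [torusCoeff_intervalIntegral hN, intervalIntegral.integral_of_le ht]
      refine (enorm_integral_le_lintegral_enorm _).trans (lintegral_mono_ae ?_)
      filter_upwards [hcoeff k] with s hs
      rw [hs, enorm_mul, ← ofReal_norm (e k s : ℂ), Complex.norm_real,
        Real.norm_of_nonneg (Real.exp_nonneg _)]
    have h2 := h1.trans (ENNReal.lintegral_mul_le_Lp_mul_Lq μ Real.HolderConjugate.two_two
      hem (hmeas k).enorm)
    calc _ ≤ _ := pow_le_pow_left' h2 2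
      _ = (∫⁻ s, ENNReal.ofReal (e k s) ^ 2 ∂μ) * ∫⁻ s, ‖torusCoeff (N s) k‖ₑ ^ 2 ∂μ := by
        simp only [ENNReal.rpow_two]
        rw [mul_pow, ← ENNReal.rpow_natCast, ← ENNReal.rpow_natCast, ← ENNReal.rpow_mul,
          ← ENNReal.rpow_mul]
        norm_num
      _ ≤ _ := mul_le_mul_left (lintegral_exp_sq_le (symbol_pos hm k) ht) _
  rw [h1Energy_eq_tsum_enorm]
  calc _ ≤ ∑' k, ENNReal.ofReal (1 / m ^ 2 + 1) * ∫⁻ s, ‖torusCoeff (N s) k‖ₑ ^ 2 ∂μ := by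
        refine ENNReal.tsum_le_tsum fun k => ?_
        refine (mul_le_mul_right (hsq k) _).trans ?_
        have hpos := symbol_pos hm k
        have hf := freqSq_nonneg k
        rw [← mul_assoc, ← ENNReal.ofReal_mul (by linarith)]
        refine mul_le_mul_left (ENNReal.ofReal_le_ofReal ?_) _
        rw [mul_one_div, div_le_iff₀ (by positivity)]
        nlinarith [one_add_freqSq_le hm k]
    _ = ENNReal.ofReal (1 / m ^ 2 + 1) * ∫⁻ s, ‖N s‖ₑ ^ 2 ∂μ := by
        rw [ENNReal.tsum_mul_left, ← lintegral_tsum fun k => (hmeas k).enorm.pow_const 2]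
        simp only [enorm_sq_eq_tsum]

lemma eq_zero_of_h1Energy_eq_zero {f : L2} (h : h1Energy f = 0) : f = 0 := by
  refine ext_torusCoeff fun k => ?_
  have h1 := ENNReal.tsum_eq_zero.1 h k
  have hf := freqSq_nonneg k
  rw [ENNReal.ofReal_eq_zero] at h1
  rw [torusCoeff_zero]
  by_contra hne
  have : 0 < ‖torusCoeff f k‖ ^ 2 := by positivity
  nlinarith

/-- Two mild solutions in `C([0,T]; H¹)` with the same data agree. -/
lemma IsMildSolution.eq_of_mem_Icc {m T : ℝ} (hm : 0 < m) {h : ℝ → L2} {z : L2}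
    {w w' : ℝ → L2} (hw : IsMildSolution m T h z w) (hw' : IsMildSolution m T h z w') :
    ∀ t ∈ Set.Icc 0 T, w' t = w t := by
  obtain ⟨M, hM, hMw⟩ := hw.memCH1.exists_h1Energy_le
  obtain ⟨M', hM', hMw'⟩ := hw'.memCH1.exists_h1Energy_le
  set κ : ℝ≥0∞ := ENNReal.ofReal (1 / m ^ 2 + 1)
  set L : ℝ≥0∞ := cubeConst * (M ^ 2 + M' ^ 2)
  have hL : L ≠ ∞ := ENNReal.mul_ne_top cubeConst_ne_top (by simp [hM, hM'])
  have hgron : ∀ t ∈ Set.Icc 0 T, h1Energy (w t - w' t)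
      ≤ κ * L * ∫⁻ s in Set.Ioc 0 t, h1Energy (w s - w' s) := by
    intro t ht
    have hheat : ∀ s ∈ Set.uIcc 0 t, heat m (t - s) (h s - cube (w s))
        - heat m (t - s) (h s - cube (w' s)) = heat m (t - s) (cube (w' s) - cube (w s)) := by
      intro s hs
      rw [Set.uIcc_of_le ht.1] at hs
      rw [← heat_sub (sub_nonneg.2 hs.2), sub_sub_sub_cancel_left]
    have hint := (hw.integrable t ht).sub (hw'.integrable t ht)
    have hint2 : IntervalIntegrable
        (fun s => heat m (t - s) (cube (w' s) - cube (w s))) volume 0 t :=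
      hint.congr fun s hs => hheat s (Set.uIoc_subset_uIcc hs)
    have heq : w t - w' t = ∫ s in (0 : ℝ)..t, heat m (t - s) (cube (w' s) - cube (w s)) := by
      rw [hw.mild t ht, hw'.mild t ht, add_sub_add_left_eq_sub,
        ← intervalIntegral.integral_sub (hw.integrable t ht) (hw'.integrable t ht)]
      exact intervalIntegral.integral_congr hheat
    rw [heq, mul_assoc]
    refine (h1Energy_integral_heat_le hm ht.1 hint2).trans ?_
    refine mul_le_mul_right ?_ _
    rw [← lintegral_const_mul' _ _ hL]
    refine lintegral_mono_ae ?_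
    filter_upwards [ae_restrict_mem measurableSet_Ioc] with s hs
    have hsT : s ∈ Set.Icc 0 T := ⟨hs.1.le, hs.2.trans ht.2⟩
    rw [← enorm_neg, neg_sub]
    refine (enorm_cube_sub_sq_le (hw.memCH1.1 s hsT) (hw'.memCH1.1 s hsT)).trans ?_
    refine mul_le_mul_left (mul_le_mul_right ?_ _) _
    exact add_le_add (pow_le_pow_left' (hMw s hsT) 2) (pow_le_pow_left' (hMw' s hsT) 2)
  intro t ht
  have h0 := eq_zero_of_le_mul_lintegral (ENNReal.mul_ne_top ENNReal.ofReal_ne_top hL)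
    (B := 2 * M + 2 * M') (by simp [ENNReal.mul_eq_top, hM, hM'])
    (fun t ht => (h1Energy_sub_le _ _).trans
      (by gcongr; exacts [hMw t ht, hMw' t ht])) hgron t ht
  exact (sub_eq_zero.1 (eq_zero_of_h1Energy_eq_zero h0)).symm

end Skeleton

end

theorem mainTheorem10 (m : ℝ) (hm : 0 < m) (T : ℝ) (hT : 0 < T)
    (φ : Skeleton.L2) (hφ : Skeleton.MemH1 φ) :
    ∃ h : ℝ → Skeleton.L2, Skeleton.MemL2L2 T h ∧
      ∃ w : ℝ → Skeleton.L2, Skeleton.IsMildSolution m T h 0 w ∧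
        (∀ w' : ℝ → Skeleton.L2, Skeleton.IsMildSolution m T h 0 w' →
          ∀ t ∈ Set.Icc 0 T, w' t = w t) ∧
        w T = φ := by
  have hw := Skeleton.isMildSolution_trajectory hm hT hφ
  exact ⟨_, (Skeleton.memL2L2_control hm hT hφ).add (Skeleton.memL2L2_cube hw.memCH1), _, hw,
    fun w' hw' => hw.eq_of_mem_Icc hm hw', Skeleton.trajectory_end hT φ⟩
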